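/- For $\alpha,\beta>-1$ let $P_n^{(\alpha,\beta)}$ be the Jacobi polynomial of degree $n$, orthogonal on $[-1,1]$ with respect to $(1-t)^{\alpha}(1+t)^{\beta}$ and normalized by $P_n^{(\alpha,\beta)}(1)=\binom{n+\alpha}{n}$. Let $\lambda,\mu\ge 0$ and $\lambda\ge\delta>-1$, and put $a=\lambda+\mu+\delta$, $b=\lambda+\mu-1$. Then there is a constant $c>0$, depending only on $\lambda,\mu,\delta$, such that for every integer $n\ge 1$ $$ \int_{0}^1 \left| \int_{-1}^1 P_n^{(a+\frac12,\,b+\frac12)} (t y)\,(1-t^2)^{\mu-1}\, dt \right| |y|^{2\mu} (1-y^2)^{\lambda -\frac12}\, dy \;\ge\; c\, n^{-\mu -\frac12}\begin{cases} \log n, & \text{if } \delta = \lambda,\\ 1, &\text{if } -1<\delta < \lambda. \end{cases} $$ When $\mu=0$ the inner integral is understood in the normalized limit sense $$ \lim_{\mu\to0^+} \Big(\int_{-1}^1 (1-t^2)^{\mu-1}dt\Big)^{-1}\int_{-1}^1 f(t)(1-t^2)^{\mu-1}\,dt=\tfrac12\,[f(1)+f(-1)], $$ that is, it is replaced by $\tfrac12\big[P_n^{(a+\frac12,b+\frac12)}(y)+P_n^{(a+\frac12,b+\frac12)}(-y)\big]$.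 -/

import Mathlib

noncomputable section

open Polynomial in
/-- The Jacobi polynomial `P_n^{(α,β)}` in the classical normalization `P_n^{(α,β)}(1) = (α+1)_n / n!`,
`P_n^{(α,β)}(x) = ∑_{k=0}^n (n+α+β+1)_k (α+k+1)_{n-k} / (k! (n-k)!) * ((x-1)/2)^k`,
where `(z)_k` is the rising factorial. -/
def jacobiP (n : ℕ) (α β : ℝ) : ℝ[X] :=
  ∑ k ∈ Finset.range (n + 1),
    C ((ascPochhammer ℝ k).eval (n + α + β + 1) * (ascPochhammer ℝ (n - k)).eval (α + k + 1)
        / ((k.factorial : ℝ) * ((n - k).factorial : ℝ)))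
      * (C (1 / 2) * (X - 1)) ^ k

/-- The integral `∫_{-1}^1 f(t) (1-t²)^{μ-1} dt` for `μ > 0`. For `μ = 0` it is understood as the limit,
as `μ → 0+`, of the integrals against the weight `(1-t²)^{μ-1}` normalized to total mass one,
which is `(f(1) + f(-1)) / 2`. -/
def gegenbauerIntegral (μ : ℝ) (f : ℝ → ℝ) : ℝ :=
  if μ = 0 then (f 1 + f (-1)) / 2
  else ∫ t in (-1 : ℝ)..1, f t * (1 - t ^ 2) ^ (μ - 1)

end

/-!
After the substitution `y = cos θ` the integral to be estimated is, up to a constant, the integral of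
`|G (cos θ)| |cos θ| ^ (2 μ) |sin θ| ^ (2 λ)` over `(0, π)`, where
`G y = ∫ P_n^{(α,β)}(t y) (1 - t ^ 2) ^ (μ - 1) dt` is an even polynomial,
`α = λ + μ + δ + 1 / 2` and `β = λ + μ - 1 / 2`. On the circle `w = e ^ {iθ}` this is the integral of
the modulus of an analytic function, because `|1 - w ^ 2| = 2 |sin θ|`, `|1 + w ^ 2| = 2 |cos θ|` and
`w ^ n G((w + w⁻¹) / 2)` is a polynomial (`gegenbauerLift`); to keep the function even and analytic,
`|cos θ| ^ (2 μ)` is first lowered to an integer power. By Cauchy's theorem it dominates the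
integral of the same function over the real radius `(0, 1)` (`integral_lift_le`). There the argument
`(w + w⁻¹) / 2` exceeds `1`, where Jacobi polynomials do not oscillate, and no cancellation is left
to be understood.

On the radius, `w ^ n P_n^{(α,β)}((w + w⁻¹) / 2)` is the polynomial `jacobiLift`, whose coefficients
are the Fourier coefficients of `P_n^{(α,β)}(cos θ)`. The Jacobi differential equation is a three-term
recursion for them. It shows that they are nonnegative (`coeff_jacobiLift_nonneg`), and, compared with
its limit as `n → ∞`, that the `j`-th one, for `j = O(√n)`, is at least a multiple of `n ^ (-1 / 2)`
times the `j`-th coefficient of `(1 - w ^ 2) ^ (-(λ + μ)) (1 - w) ^ (-(δ + 1))`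
(`coeff_jacobiLift_ge`). Hence the even part of the Jacobi polynomial, multiplied by `w ^ n`, is at
least of the order of `n ^ (-1 / 2) (1 - w ^ 2) ^ (-(λ + μ + δ + 1))` (`exists_le_evenLift`). The
values of `t` within a distance of the order of `(1 - w ^ 2) / n` of `1` contribute a further factor
`((1 - w ^ 2) / n) ^ μ` to the Gegenbauer integral (`exists_le_gegenbauerIntegral_jacobiP`). With the
factor `(1 - w ^ 2) ^ (2 λ)` of the weight, the integrand on the radius is at least of the order of
`n ^ (-μ - 1 / 2) (1 - w ^ 2) ^ (λ - δ - 1)`. Its integral up to `1 - w ^ 2 = n ^ (-1 / 4)` produces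
the logarithm exactly when `δ = λ` (`exists_le_integral_radius`).

These bounds hold up to errors which are `w ^ n` times a power of `n`, from the values of the Jacobi
polynomial on `[-1, 1]`, and which are not small for `1 - w ^ 2 = O(1 / n)`. For this reason
`(1 - w ^ 2) ^ (2 λ)` is replaced by `(1 - w ^ 2) ^ K (1 + η - w ^ 2) ^ (2 λ - K)` with
`η = n ^ (-1 / 4)` and `K` large (`radialWeight`), which is not larger in modulus on the circle,
comparable on the range of `w` that matters, and tiny close to `1`. The finitely many remaining `n`
only require that the integral is positive (`integral_abs_gegenbauer_pos`).
-/

/-! ### Fourier coefficients of Jacobi polynomials -/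

section JacobiLift

open Polynomial

/-- The coefficient of `((x - 1) / 2) ^ k` in `P_n^{(α,β)}`. -/
noncomputable def jacobiCoeff (n : ℕ) (α β : ℝ) (k : ℕ) : ℝ :=
  (ascPochhammer ℝ k).eval (n + α + β + 1) * (ascPochhammer ℝ (n - k)).eval (α + k + 1)
        / ((k.factorial : ℝ) * ((n - k).factorial : ℝ))

lemma ascPochhammer_eval_succ_left (k : ℕ) (x : ℝ) :
    (ascPochhammer ℝ (k + 1)).eval x = x * (ascPochhammer ℝ k).eval (x + 1) := by
  rw [ascPochhammer_succ_left]; simp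

lemma jacobiCoeff_succ {n k : ℕ} (hk : k < n) (α β : ℝ) :
    jacobiCoeff n α β (k + 1) * ((k + 1) * (α + k + 1)) =
      jacobiCoeff n α β k * ((n + (α + β + 1) + k) * (n - k)) := by
  obtain ⟨m, rfl⟩ : ∃ m, n = k + 1 + m := ⟨n - (k + 1), by omega⟩
  unfold jacobiCoeff
  have h1 : k + 1 + m - (k + 1) = m := by omega
  have h2 : k + 1 + m - k = m + 1 := by omega
  rw [h1, h2, ascPochhammer_eval_succ_left m, ascPochhammer_succ_eval, Nat.factorial_succ,
    Nat.factorial_succ]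
  have : α + ((k + 1 : ℕ) : ℝ) + 1 = α + k + 1 + 1 := by push_cast; ring
  rw [this]
  have h3 : (k.factorial : ℝ) ≠ 0 := by positivity
  have h4 : (m.factorial : ℝ) ≠ 0 := by positivity
  push_cast
  field_simp
  ring

/-- The polynomial `w ^ n * P_n^{(α,β)}((w + w⁻¹) / 2)`. On the unit circle it carries the Fourier
coefficients of `θ ↦ P_n^{(α,β)}(cos θ)`, and on `(0, 1)` the values of `P_n^{(α,β)}` on
`(1, ∞)`. -/
noncomputable def jacobiLift (n : ℕ) (α β : ℝ) : ℝ[X] :=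
  ∑ k ∈ Finset.range (n + 1),
    C (jacobiCoeff n α β k / 4 ^ k) * ((X - 1) ^ (2 * k) * X ^ (n - k))

lemma aeval_jacobiLift {K : Type*} [Field K] [CharZero K] [Algebra ℝ K] (n : ℕ) (α β : ℝ) {w : K}
    (hw : w ≠ 0) :
    aeval w (jacobiLift n α β) = w ^ n * aeval ((w + w⁻¹) / 2) (jacobiP n α β) := by
  unfold jacobiLift jacobiP
  rw [map_sum, map_sum, Finset.mul_sum]
  refine Finset.sum_congr rfl fun k hk => ?_
  have hk' : k ≤ n := by simpa [Nat.lt_succ_iff] using hk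
  obtain ⟨m, rfl⟩ := Nat.exists_eq_add_of_le hk'
  rw [Nat.add_sub_cancel_left]
  simp only [map_mul, map_pow, map_sub, aeval_X, aeval_C, map_one]
  have e1 : algebraMap ℝ K (1 / 2) * ((w + w⁻¹) / 2 - 1) = (w - 1) ^ 2 / (4 * w) := by
    rw [map_div₀, map_one, map_ofNat]
    field_simp
    ring
  rw [e1, map_div₀, map_pow, map_ofNat, jacobiCoeff, Nat.add_sub_cancel_left]
  rw [div_pow, mul_pow, ← pow_mul, pow_add]
  field_simp

lemma eval_jacobiLift (n : ℕ) (α β : ℝ) {w : ℝ} (hw : w ≠ 0) :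
    (jacobiLift n α β).eval w = w ^ n * (jacobiP n α β).eval ((w + w⁻¹) / 2) := by
  simpa [coe_aeval_eq_eval] using aeval_jacobiLift (K := ℝ) n α β hw

/-- The Euler operator `X d/dX` on polynomials. -/
noncomputable def eulerOp (p : ℝ[X]) : ℝ[X] := X * derivative p

lemma eulerOp_mul (p q : ℝ[X]) : eulerOp (p * q) = eulerOp p * q + p * eulerOp q := by
  unfold eulerOp; rw [derivative_mul]; ring

lemma eulerOp_C_mul (c : ℝ) (p : ℝ[X]) : eulerOp (C c * p) = C c * eulerOp p := by
  unfold eulerOp; rw [derivative_C_mul]; ring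

lemma eulerOp_sum {ι : Type*} (s : Finset ι) (f : ι → ℝ[X]) :
    eulerOp (∑ i ∈ s, f i) = ∑ i ∈ s, eulerOp (f i) := by
  unfold eulerOp; rw [derivative_sum, Finset.mul_sum]

lemma eulerOp_X_pow (m : ℕ) : eulerOp (X ^ m) = (m : ℝ[X]) * X ^ m := by
  unfold eulerOp
  cases m with
  | zero => simp
  | succ m => rw [derivative_X_pow]; simp; ring

lemma eulerOp_X_sub_one_pow (m : ℕ) :
    (X - 1) * eulerOp ((X - 1) ^ m) = (m : ℝ[X]) * X * (X - 1) ^ m := by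
  unfold eulerOp
  cases m with
  | zero => simp
  | succ m => rw [derivative_pow]; simp; ring

lemma coeff_eulerOp (p : ℝ[X]) (j : ℕ) : (eulerOp p).coeff j = j * p.coeff j := by
  unfold eulerOp
  cases j with
  | zero => simp
  | succ j => rw [coeff_X_mul, coeff_derivative]; push_cast; ring

/-- The Jacobi differential operator in the variable `w`, where `x = (w + w⁻¹) / 2`, acting on
`w ^ n` times a function of `x`. -/
noncomputable def liftOp (n : ℕ) (s d : ℝ) (p : ℝ[X]) : ℝ[X] :=
  (1 - X ^ 2) * (-eulerOp (eulerOp p) + 2 * (n : ℝ[X]) * eulerOp p + C (n * s) * p)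
    + (C s * (1 + X ^ 2) + 2 * C d * X) * (eulerOp p - (n : ℝ[X]) * p)

lemma liftOp_C_mul (n : ℕ) (s d c : ℝ) (p : ℝ[X]) :
    liftOp n s d (C c * p) = C c * liftOp n s d p := by
  unfold liftOp; simp only [eulerOp_C_mul]; ring

lemma liftOp_sum {ι : Type*} (n : ℕ) (s d : ℝ) (S : Finset ι) (f : ι → ℝ[X]) :
    liftOp n s d (∑ i ∈ S, f i) = ∑ i ∈ S, liftOp n s d (f i) := by
  unfold liftOp
  rw [Finset.sum_add_distrib, ← Finset.mul_sum, ← Finset.mul_sum, Finset.sum_add_distrib,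
    Finset.sum_add_distrib, Finset.sum_sub_distrib, Finset.sum_neg_distrib, ← Finset.mul_sum,
    ← Finset.mul_sum, ← Finset.mul_sum, eulerOp_sum, eulerOp_sum]

/-- The Jacobi operator maps the `k`-th basis function of `jacobiLift` to `1 - X ^ 2` times a
combination of the `k`-th and the `(k - 1)`-st. The factor `(X - 1) ^ 2` avoids the exponent `2 * (k - 1)`, and `4 * (k + α) * k`
and `m * (2 * k + m + α + β + 1)` are the two sides of the recursion `jacobiCoeff_succ`. -/
lemma liftOp_basis (k m : ℕ) (α β : ℝ) :
    (X - 1) ^ 2 * liftOp (k + m) (α + β + 1) (α - β) ((X - 1) ^ (2 * k) * X ^ m) =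
      (1 - X ^ 2) * (C (m * (k + m + k + (α + β + 1))) * ((X - 1) ^ 2 * ((X - 1) ^ (2 * k) * X ^ m))
        - C (4 * k * (k + α)) * (X * ((X - 1) ^ (2 * k) * X ^ m))) := by
  set e : ℝ[X] := (X - 1) ^ (2 * k) * X ^ m with he
  have h1 : (X - 1) * eulerOp e = (2 * (k : ℝ[X]) * X + (m : ℝ[X]) * (X - 1)) * e := by
    rw [he, eulerOp_mul, eulerOp_X_pow]
    have := eulerOp_X_sub_one_pow (2 * k)
    push_cast at this
    linear_combination X ^ m * this
  have h2 : X * eulerOp e + (X - 1) * eulerOp (eulerOp e) =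
      (2 * (k : ℝ[X]) * X + (m : ℝ[X]) * X) * e
        + (2 * (k : ℝ[X]) * X + (m : ℝ[X]) * (X - 1)) * eulerOp e := by
    have := congrArg eulerOp h1
    rw [eulerOp_mul, eulerOp_mul _ e] at this
    have h3 : eulerOp ((X : ℝ[X]) - 1) = X := by simp [eulerOp]
    have h4 : eulerOp (2 * (k : ℝ[X]) * X + (m : ℝ[X]) * (X - 1)) =
        2 * (k : ℝ[X]) * X + (m : ℝ[X]) * X := by
      unfold eulerOp
      simp [derivative_mul]
      ring
    rw [h3, h4] at this
    exact this
  unfold liftOp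
  simp only [map_mul, map_add, map_sub, map_natCast, map_ofNat, map_one]
  push_cast
  clear_value e
  linear_combination
    (-(1 - X ^ 2) * (2 * (k : ℝ[X]) * X + m * (X - 1) - X) + 2 * (k + m) * (X - 1) * (1 - X ^ 2)
      + (X - 1) * ((C α + C β + 1) * (1 + X ^ 2) + 2 * (C α - C β) * X)) * h1
    - (1 - X ^ 2) * (X - 1) * h2

/-- The Jacobi differential equation, in the variable `w`. -/
lemma liftOp_jacobiLift (n : ℕ) (α β : ℝ) :
    liftOp n (α + β + 1) (α - β) (jacobiLift n α β) = 0 := by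
  have hX : (X - 1 : ℝ[X]) ≠ 0 := by
    simpa using X_sub_C_ne_zero (1 : ℝ)
  have key : (X - 1) ^ 2 * liftOp n (α + β + 1) (α - β) (jacobiLift n α β) = 0 := by
    have e1 : (X - 1) ^ 2 * liftOp n (α + β + 1) (α - β) (jacobiLift n α β) =
        (1 - X ^ 2) * (∑ k ∈ Finset.range (n + 1),
            C (jacobiCoeff n α β k / 4 ^ k * ((n + (α + β + 1) + k) * (n - k))) *
              ((X - 1) ^ (2 * (k + 1)) * X ^ (n - k))
          - ∑ k ∈ Finset.range (n + 1),
            C (jacobiCoeff n α β k / 4 ^ k * (4 * k * (k + α))) *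
              (X * ((X - 1) ^ (2 * k) * X ^ (n - k)))) := by
      rw [jacobiLift, liftOp_sum, Finset.mul_sum, ← Finset.sum_sub_distrib, Finset.mul_sum]
      refine Finset.sum_congr rfl fun k hk => ?_
      have hk' : k ≤ n := by simpa [Nat.lt_succ_iff] using hk
      obtain ⟨m, rfl⟩ := Nat.exists_eq_add_of_le hk'
      rw [Nat.add_sub_cancel_left, liftOp_C_mul, mul_left_comm, liftOp_basis]
      push_cast
      simp only [map_mul, map_add, map_sub, map_natCast, map_ofNat, map_one]
      ring
    rw [e1, Finset.sum_range_succ, Finset.sum_range_succ' _ n]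
    have e2 : ∀ k ∈ Finset.range n,
        C (jacobiCoeff n α β k / 4 ^ k * ((n + (α + β + 1) + k) * (n - k))) *
              ((X - 1) ^ (2 * (k + 1)) * X ^ (n - k)) =
        C (jacobiCoeff n α β (k + 1) / 4 ^ (k + 1) * (4 * (k + 1 : ℕ) * ((k + 1 : ℕ) + α))) *
              (X * ((X - 1) ^ (2 * (k + 1)) * X ^ (n - (k + 1)))) := by
      intro k hk
      have hk' := Finset.mem_range.1 hk
      have h := jacobiCoeff_succ hk' α β
      have h5 : n - k = n - (k + 1) + 1 := by omega
      have h6 : jacobiCoeff n α β k / 4 ^ k * ((n + (α + β + 1) + k) * (n - k)) =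
          jacobiCoeff n α β (k + 1) / 4 ^ (k + 1) * (4 * (k + 1 : ℕ) * ((k + 1 : ℕ) + α)) := by
        rw [div_mul_eq_mul_div, ← h]
        push_cast
        field_simp
        ring
      rw [h6, h5, pow_succ]
      ring
    rw [Finset.sum_congr rfl e2]
    simp
  exact (mul_eq_zero.1 key).resolve_left (pow_ne_zero 2 hX)

/-- `liftOp` sorted by powers of `X`, ready for the comparison of coefficients. -/
lemma liftOp_eq (n : ℕ) (s d : ℝ) (U : ℝ[X]) : liftOp n s d U =
    -eulerOp (eulerOp U) + C (2 * n : ℝ) * eulerOp U + C (n * s) * U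
     + X ^ 2 * (eulerOp (eulerOp U) - C (2 * n : ℝ) * eulerOp U - C (n * s) * U)
     + C s * (eulerOp U - C (n : ℝ) * U)
     + X ^ 2 * (C s * (eulerOp U - C (n : ℝ) * U))
     + X * (C (2 * d) * (eulerOp U - C (n : ℝ) * U)) := by
  unfold liftOp
  simp only [map_mul, map_natCast, map_ofNat]
  ring

lemma coeff_jacobiLift_one (n : ℕ) (α β : ℝ) :
    (jacobiLift n α β).coeff 1 * (2 * n - 1 + (α + β + 1)) =
      2 * (α - β) * n * (jacobiLift n α β).coeff 0 := by
  have h := congrArg (fun p => coeff p 1) (liftOp_jacobiLift n α β)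
  simp only [liftOp_eq] at h
  have hx : ∀ p : ℝ[X], (X * p).coeff 1 = p.coeff 0 := fun p => coeff_X_mul p 0
  have hx2 : ∀ p : ℝ[X], (X ^ 2 * p).coeff 1 = 0 := fun p => by
    rw [coeff_X_pow_mul']; simp
  simp only [coeff_add, coeff_neg, coeff_sub, coeff_C_mul, hx2, hx, coeff_eulerOp,
    coeff_zero] at h
  push_cast at h
  linear_combination h

/-- The differential equation as a three-term recursion for the Fourier coefficients. For `α ≥ β` and
`j + 2 ≤ n` all its factors are nonnegative. -/
lemma coeff_jacobiLift_add_two (n : ℕ) (α β : ℝ) (j : ℕ) :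
    (jacobiLift n α β).coeff (j + 2) * ((j + 2) * (2 * n - j - 2 + (α + β + 1))) =
      2 * (α - β) * (n - j - 1) * (jacobiLift n α β).coeff (j + 1)
        + (2 * n - j) * (j + (α + β + 1)) * (jacobiLift n α β).coeff j := by
  have h := congrArg (fun p => coeff p (j + 2)) (liftOp_jacobiLift n α β)
  simp only [liftOp_eq] at h
  have hx : ∀ p : ℝ[X], (X * p).coeff (j + 2) = p.coeff (j + 1) := fun p => coeff_X_mul p (j + 1)
  simp only [coeff_add, coeff_neg, coeff_sub, coeff_C_mul, coeff_X_pow_mul, hx, coeff_eulerOp,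
    coeff_zero] at h
  push_cast at h
  linear_combination h

lemma natDegree_X_sub_one : natDegree ((X : ℝ[X]) - 1) = 1 := by
  simpa using natDegree_X_sub_C (1 : ℝ)

lemma natDegree_lift_basis_le (k m : ℕ) :
    ((X - 1 : ℝ[X]) ^ (2 * k) * X ^ m).natDegree ≤ 2 * k + m := by
  refine natDegree_mul_le.trans ?_
  have h2 := natDegree_pow_le (p := (X : ℝ[X]) - 1) (n := 2 * k)
  rw [natDegree_X_sub_one, mul_one] at h2
  have h3 := natDegree_X_pow_le (R := ℝ) m
  omega

lemma natDegree_jacobiLift_le (n : ℕ) (α β : ℝ) : (jacobiLift n α β).natDegree ≤ 2 * n := by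
  unfold jacobiLift
  refine natDegree_sum_le_of_forall_le _ _ fun k hk => ?_
  have hk' : k ≤ n := by simpa [Nat.lt_succ_iff] using hk
  refine (natDegree_C_mul_le _ _).trans ((natDegree_lift_basis_le _ _).trans ?_)
  omega

lemma jacobiCoeff_self (n : ℕ) (α β : ℝ) :
    jacobiCoeff n α β n = (ascPochhammer ℝ n).eval (n + α + β + 1) / n.factorial := by
  simp [jacobiCoeff]

lemma coeff_jacobiLift_zero (n : ℕ) (α β : ℝ) :
    (jacobiLift n α β).coeff 0 = jacobiCoeff n α β n / 4 ^ n := by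
  rw [coeff_zero_eq_eval_zero, jacobiLift, eval_finsetSum, Finset.sum_range_succ,
    Finset.sum_eq_zero]
  · simp
  · intro k hk
    have := Finset.mem_range.1 hk
    simp [show n - k ≠ 0 by omega]

lemma coeff_jacobiLift_two_mul (n : ℕ) (α β : ℝ) :
    (jacobiLift n α β).coeff (2 * n) = jacobiCoeff n α β n / 4 ^ n := by
  rw [jacobiLift, finsetSum_coeff, Finset.sum_range_succ, Finset.sum_eq_zero]
  · have hm : ((X : ℝ[X]) - 1).Monic := by simpa using monic_X_sub_C (1 : ℝ)
    have h2 := (hm.pow (2 * n)).coeff_natDegree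
    rw [hm.natDegree_pow, natDegree_X_sub_one, mul_one] at h2
    simp [h2]
  · intro k hk
    have := Finset.mem_range.1 hk
    rw [coeff_C_mul, coeff_eq_zero_of_natDegree_lt, mul_zero]
    exact (natDegree_lift_basis_le _ _).trans_lt (by omega)

lemma jacobiCoeff_self_pos (n : ℕ) {α β : ℝ} (hs : 0 < α + β + 1) : 0 < jacobiCoeff n α β n := by
  rw [jacobiCoeff_self]
  have : 0 < (ascPochhammer ℝ n).eval (n + α + β + 1) :=
    ascPochhammer_pos n _ (by have : (0 : ℝ) ≤ n := n.cast_nonneg; linarith)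
  positivity

lemma coeff_jacobiLift_zero_pos (n : ℕ) {α β : ℝ} (hs : 0 < α + β + 1) :
    0 < (jacobiLift n α β).coeff 0 := by
  rw [coeff_jacobiLift_zero]
  have := jacobiCoeff_self_pos n hs
  positivity

/-- Below the middle degree, nonnegativity propagates upwards from the lowest coefficient. -/
lemma coeff_jacobiLift_nonneg_low (n : ℕ) {α β : ℝ} (hs : 0 < α + β + 1) (hd : β ≤ α) (j : ℕ)
    (hj : j ≤ n) : 0 ≤ (jacobiLift n α β).coeff j := by
  induction j using Nat.strong_induction_on with
  | _ j ih =>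
    match j with
    | 0 => exact (coeff_jacobiLift_zero_pos n hs).le
    | 1 =>
      have h := coeff_jacobiLift_one n α β
      have h0 := (coeff_jacobiLift_zero_pos n hs).le
      have hn : (1 : ℝ) ≤ n := by exact_mod_cast hj
      have h1 : 0 < 2 * (n : ℝ) - 1 + (α + β + 1) := by linarith
      refine nonneg_of_mul_nonneg_left ?_ h1
      rw [h]
      have : 0 ≤ α - β := by linarith
      positivity
    | j + 2 =>
      have h := coeff_jacobiLift_add_two n α β j
      have h0 := ih j (by omega) (by omega)
      have h1 := ih (j + 1) (by omega) (by omega)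
      have hn : (j : ℝ) + 2 ≤ n := by exact_mod_cast hj
      have hj0 : (0 : ℝ) ≤ j := j.cast_nonneg
      have hp : 0 < ((j : ℝ) + 2) * (2 * n - j - 2 + (α + β + 1)) :=
        mul_pos (by linarith) (by linarith)
      refine nonneg_of_mul_nonneg_left ?_ hp
      rw [h]
      have a1 : 0 ≤ α - β := by linarith
      have a2 : (0 : ℝ) ≤ n - j - 1 := by linarith
      have a3 : (0 : ℝ) ≤ 2 * n - j := by linarith
      have a4 : 0 ≤ j + (α + β + 1) := by linarith
      positivity

/-- Above the middle degree, nonnegativity propagates downwards from the highest coefficient: there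
the factor `n - j - 1` of the recursion is negative, so that `coeff j` is a nonnegative combination
of `coeff (j + 1)` and `coeff (j + 2)`. -/
lemma coeff_jacobiLift_nonneg_high (n : ℕ) {α β : ℝ} (hs : 0 < α + β + 1) (hd : β ≤ α) (i j : ℕ)
    (hij : i + j = 2 * n) (hj : n ≤ j) : 0 ≤ (jacobiLift n α β).coeff j := by
  induction i using Nat.strong_induction_on generalizing j with
  | _ i ih =>
    rcases Nat.eq_zero_or_pos i with rfl | hi
    · obtain rfl : j = 2 * n := by omega
      rw [coeff_jacobiLift_two_mul]
      have := jacobiCoeff_self_pos n hs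
      positivity
    · have h := coeff_jacobiLift_add_two n α β j
      have h1 := ih (i - 1) (by omega) (j + 1) (by omega) (by omega)
      have hj0 : (0 : ℝ) ≤ j := j.cast_nonneg
      have hnj : (n : ℝ) ≤ j := by exact_mod_cast hj
      have h2 : 0 ≤ (jacobiLift n α β).coeff (j + 2) *
          ((j + 2) * (2 * n - j - 2 + (α + β + 1))) := by
        rcases eq_or_ne i 1 with rfl | hi1
        · rw [coeff_eq_zero_of_natDegree_lt, zero_mul]
          exact (natDegree_jacobiLift_le n α β).trans_lt (by omega)
        · have h3 := ih (i - 2) (by omega) (j + 2) (by omega) (by omega)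
          have : (j : ℝ) + 2 ≤ 2 * n := by exact_mod_cast (by omega : j + 2 ≤ 2 * n)
          have a : (0 : ℝ) ≤ 2 * n - j - 2 + (α + β + 1) := by linarith
          positivity
      have hlt : (j : ℝ) + 1 ≤ 2 * n := by exact_mod_cast (by omega : j + 1 ≤ 2 * n)
      have hp : 0 < (2 * (n : ℝ) - j) * (j + (α + β + 1)) :=
        mul_pos (by linarith) (by linarith)
      refine nonneg_of_mul_nonneg_right ?_ hp
      have a1 : 0 ≤ (α - β) * (j + 1 - n) * (jacobiLift n α β).coeff (j + 1) :=
        mul_nonneg (mul_nonneg (by linarith) (by linarith)) h1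
      linarith

/-- The Fourier coefficients of `θ ↦ P_n^{(α,β)}(cos θ)` are nonnegative when `α ≥ β`. -/
lemma coeff_jacobiLift_nonneg (n : ℕ) {α β : ℝ} (hs : 0 < α + β + 1) (hd : β ≤ α) (j : ℕ) :
    0 ≤ (jacobiLift n α β).coeff j := by
  rcases le_total j n with h | h
  · exact coeff_jacobiLift_nonneg_low n hs hd j h
  · rcases le_or_gt j (2 * n) with h' | h'
    · exact coeff_jacobiLift_nonneg_high n hs hd (2 * n - j) j (by omega) h
    · rw [coeff_eq_zero_of_natDegree_lt]
      exact (natDegree_jacobiLift_le n α β).trans_lt h'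

/-- The lower bound of the order of `4 ^ n / √n` for the central binomial coefficient. -/
lemma four_pow_le_centralBinom (n : ℕ) (hn : 1 ≤ n) :
    (4 : ℝ) ^ n ≤ 2 * √n * n.centralBinom := by
  have key : ((4 : ℝ) ^ n) ^ 2 ≤ 4 * n * (n.centralBinom : ℝ) ^ 2 := by
    induction n, hn using Nat.le_induction with
    | base => norm_num [Nat.centralBinom]
    | succ m hm ih =>
      have h := Nat.succ_mul_centralBinom_succ m
      have h' : ((m : ℝ) + 1) * (m + 1).centralBinom = 2 * (2 * m + 1) * m.centralBinom := by
        exact_mod_cast h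
      have hm0 : (0 : ℝ) < m + 1 := by positivity
      have e : (((m + 1).centralBinom : ℕ) : ℝ) = 2 * (2 * m + 1) * m.centralBinom / (m + 1) := by
        rw [eq_div_iff hm0.ne', ← h']; ring
      rw [e, pow_succ (4 : ℝ) m, mul_pow]
      push_cast
      have : 4 * ((m : ℝ) + 1) * (2 * (2 * m + 1) * m.centralBinom / (m + 1)) ^ 2
          = 16 * (m.centralBinom : ℝ) ^ 2 * (2 * m + 1) ^ 2 / (m + 1) := by
        field_simp; ring
      rw [this, le_div_iff₀ hm0]
      nlinarith [sq_nonneg (m.centralBinom : ℝ)]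
  have h2 : (4 : ℝ) * n * (n.centralBinom : ℝ) ^ 2 = (2 * √n * n.centralBinom) ^ 2 := by
    rw [mul_pow, mul_pow, Real.sq_sqrt n.cast_nonneg]; ring
  rw [h2] at key
  exact (abs_le_of_sq_le_sq' key (by positivity)).2

lemma ascPochhammer_eval_mono (n : ℕ) {x y : ℝ} (hx : 0 < x) (hxy : x ≤ y) :
    (ascPochhammer ℝ n).eval x ≤ (ascPochhammer ℝ n).eval y := by
  induction n with
  | zero => simp
  | succ n ih =>
    rw [ascPochhammer_succ_eval, ascPochhammer_succ_eval]
    have := (ascPochhammer_pos n x hx).le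
    exact mul_le_mul ih (by linarith) (by positivity) (this.trans ih)

/-- The extreme Fourier coefficients of `P_n^{(α,β)}` are at least of the order of `n ^ (-1 / 2)`,
by comparison with `α + β + 1 = 0`, where they are
`4 ^ (-n)` times half a central binomial coefficient. -/
lemma le_coeff_jacobiLift_zero (n : ℕ) (hn : 1 ≤ n) {α β : ℝ} (hs : 0 < α + β + 1) :
    1 / (4 * √n) ≤ (jacobiLift n α β).coeff 0 := by
  rw [coeff_jacobiLift_zero, jacobiCoeff_self]
  have hn' : (0 : ℝ) < n := by exact_mod_cast hn
  have h1 : (ascPochhammer ℝ n).eval (n : ℝ) ≤ (ascPochhammer ℝ n).eval (n + α + β + 1) :=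
    ascPochhammer_eval_mono n hn' (by linarith)
  have h2 : (ascPochhammer ℝ n).eval ((n : ℝ) + 1) = n.factorial * n.centralBinom := by
    have := Nat.cast_ascFactorial (S := ℝ) (n + 1) n
    rw [Nat.ascFactorial_eq_factorial_mul_choose] at this
    push_cast at this
    rw [← this, Nat.centralBinom, two_mul]
  have h3 : 2 * (ascPochhammer ℝ n).eval (n : ℝ) = (ascPochhammer ℝ n).eval ((n : ℝ) + 1) := by
    have a := ascPochhammer_eval_succ_left n (n : ℝ)
    rw [ascPochhammer_succ_eval] at a
    have : (n : ℝ) * (2 * (ascPochhammer ℝ n).eval (n : ℝ)) =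
      n * (ascPochhammer ℝ n).eval ((n : ℝ) + 1) := by linarith
    exact mul_left_cancel₀ hn'.ne' this
  have h4 := four_pow_le_centralBinom n hn
  have hf : (0 : ℝ) < n.factorial := by positivity
  have hsq : 0 < √(n : ℝ) := Real.sqrt_pos.2 hn'
  rw [div_div, div_le_div_iff₀ (by positivity) (by positivity), one_mul]
  calc (n.factorial : ℝ) * 4 ^ n ≤ n.factorial * (2 * √n * n.centralBinom) := by gcongr
    _ = (2 * (ascPochhammer ℝ n).eval (n : ℝ)) * (2 * √n) := by rw [h3, h2]; ring
    _ ≤ (2 * (ascPochhammer ℝ n).eval (n + α + β + 1)) * (2 * √n) := by gcongr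
    _ = _ := by ring

lemma eval_one_jacobiLift (n : ℕ) (α β : ℝ) :
    (jacobiLift n α β).eval 1 = (ascPochhammer ℝ n).eval (α + 1) / n.factorial := by
  rw [jacobiLift, eval_finsetSum, Finset.sum_range_succ', Finset.sum_eq_zero]
  · simp [jacobiCoeff]
  · intro k hk
    simp

/-- The maximum of the Jacobi polynomial on `[-1, 1]`, which is its value at `1`, grows at most
polynomially in `n`. -/
lemma eval_one_jacobiLift_le (n q : ℕ) {α : ℝ} (β : ℝ) (hα : -1 < α) (hq : α ≤ q) :
    (jacobiLift n α β).eval 1 ≤ (n + 1) ^ q := by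
  rw [eval_one_jacobiLift]
  induction n with
  | zero => simp
  | succ n ih =>
    rw [ascPochhammer_succ_eval, Nat.factorial_succ]
    have hn : (0 : ℝ) < n + 1 := by positivity
    have e : (ascPochhammer ℝ n).eval (α + 1) * (α + 1 + n) / ((n + 1) * n.factorial : ℕ) =
        (ascPochhammer ℝ n).eval (α + 1) / n.factorial * ((α + 1 + n) / (n + 1)) := by
      push_cast
      field_simp
    have h1 : (α + 1 + n) / (n + 1) ≤ (1 + 1 / ((n : ℝ) + 1)) ^ q := by
      have := one_add_mul_le_pow (a := 1 / ((n : ℝ) + 1)) (by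
        have : 0 ≤ 1 / ((n : ℝ) + 1) := by positivity
        linarith) q
      refine le_trans ?_ this
      rw [div_le_iff₀ hn]
      have : (1 + q * (1 / ((n : ℝ) + 1))) * (n + 1) = n + 1 + q := by field_simp
      rw [this]; linarith
    have h2 : 0 ≤ (α + 1 + n) / (n + 1) := by
      have : 0 ≤ α + 1 := by linarith
      positivity
    rw [e]
    calc _ ≤ ((n : ℝ) + 1) ^ q * (1 + 1 / ((n : ℝ) + 1)) ^ q :=
          mul_le_mul ih h1 h2 (by positivity)
      _ = _ := by
          rw [← mul_pow]; congr 1; push_cast; field_simp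

end JacobiLift

/-! ### The even part of a Jacobi polynomial -/

section EvenPart

open Polynomial

/-- The function `w ^ n` times the even part of `P_n^{(α,β)}` at `(w + w⁻¹) / 2`: the part of
`jacobiLift` whose exponents have the parity of `n`. -/
noncomputable def evenLift (n : ℕ) (α β : ℝ) (w : ℝ) : ℝ :=
  ∑ j ∈ (Finset.range (2 * n + 1)).filter (fun j => j % 2 = n % 2),
    (jacobiLift n α β).coeff j * w ^ j

lemma evenLift_eq (n : ℕ) (α β : ℝ) {w : ℝ} (hw : w ≠ 0) :
    evenLift n α β w = w ^ n * (((jacobiP n α β).eval ((w + w⁻¹) / 2)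
      + (jacobiP n α β).eval (-((w + w⁻¹) / 2))) / 2) := by
  have h1 := eval_jacobiLift n α β hw
  have h2 := eval_jacobiLift n α β (neg_ne_zero.2 hw)
  have e : (-w + (-w)⁻¹) / 2 = -((w + w⁻¹) / 2) := by rw [inv_neg]; ring
  rw [e, neg_pow] at h2
  have hs : (-1 : ℝ) ^ n * (-1) ^ n = 1 := by rw [← mul_pow]; norm_num
  have h3 : w ^ n * (((jacobiP n α β).eval ((w + w⁻¹) / 2)
      + (jacobiP n α β).eval (-((w + w⁻¹) / 2))) / 2) =
      ((jacobiLift n α β).eval w + (-1) ^ n * (jacobiLift n α β).eval (-w)) / 2 := by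
    rw [h1, h2]
    linear_combination (-(w ^ n * (jacobiP n α β).eval (-((w + w⁻¹) / 2))) / 2) * hs
  have hdeg : (jacobiLift n α β).natDegree < 2 * n + 1 :=
    Nat.lt_succ_of_le (natDegree_jacobiLift_le n α β)
  rw [h3, eval_eq_sum_range' hdeg, eval_eq_sum_range' hdeg, Finset.mul_sum,
    ← Finset.sum_add_distrib, Finset.sum_div, evenLift, Finset.sum_filter]
  refine Finset.sum_congr rfl fun j _ => ?_
  rw [neg_pow w j]
  rcases Nat.even_or_odd j with hj | hj <;> rcases Nat.even_or_odd n with hn | hn <;>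
    rw [hj.neg_one_pow, hn.neg_one_pow]
  · rw [if_pos (by rw [Nat.even_iff.1 hj, Nat.even_iff.1 hn])]; ring
  · rw [if_neg (by rw [Nat.even_iff.1 hj, Nat.odd_iff.1 hn]; norm_num)]; ring
  · rw [if_neg (by rw [Nat.odd_iff.1 hj, Nat.even_iff.1 hn]; norm_num)]; ring
  · rw [if_pos (by rw [Nat.odd_iff.1 hj, Nat.odd_iff.1 hn])]; ring

lemma evenLift_nonneg (n : ℕ) {α β : ℝ} (hs : 0 < α + β + 1) (hd : β ≤ α) {w : ℝ} (hw : 0 ≤ w) :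
    0 ≤ evenLift n α β w :=
  Finset.sum_nonneg fun j _ => mul_nonneg (coeff_jacobiLift_nonneg n hs hd j) (pow_nonneg hw j)

lemma evenLift_mono (n : ℕ) {α β : ℝ} (hs : 0 < α + β + 1) (hd : β ≤ α) {v w : ℝ} (hv : 0 ≤ v)
    (hvw : v ≤ w) : evenLift n α β v ≤ evenLift n α β w :=
  Finset.sum_le_sum fun j _ => mul_le_mul_of_nonneg_left (pow_le_pow_left₀ hv hvw j)
    (coeff_jacobiLift_nonneg n hs hd j)

/-- On `[-1, 1]` the Jacobi polynomial is bounded by its value at `1`, since its Fourier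
coefficients are nonnegative. -/
lemma abs_eval_jacobiP_le (n : ℕ) {α β : ℝ} (hs : 0 < α + β + 1) (hd : β ≤ α) {x : ℝ}
    (hx : |x| ≤ 1) : |(jacobiP n α β).eval x| ≤ (jacobiLift n α β).eval 1 := by
  obtain ⟨hx1, hx2⟩ := abs_le.1 hx
  set θ := Real.arccos x
  set w : ℂ := Complex.exp (θ * Complex.I) with hw
  have hw1 : ‖w‖ = 1 := Complex.norm_exp_ofReal_mul_I θ
  have hw0 : w ≠ 0 := Complex.exp_ne_zero _
  have hy : (w + w⁻¹) / 2 = (x : ℂ) := by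
    rw [hw, ← Complex.exp_neg, ← neg_mul, ← Real.cos_arccos hx1 hx2, Complex.ofReal_cos]
    rfl
  have h := aeval_jacobiLift n α β hw0
  rw [hy] at h
  have h2 : aeval (x : ℂ) (jacobiP n α β) = (((jacobiP n α β).eval x : ℝ) : ℂ) := by
    have := aeval_algebraMap_apply ℂ x (jacobiP n α β)
    simpa [coe_aeval_eq_eval] using this
  have h3 : |(jacobiP n α β).eval x| = ‖aeval w (jacobiLift n α β)‖ := by
    rw [h, h2, norm_mul, norm_pow, hw1, one_pow, one_mul, Complex.norm_real, Real.norm_eq_abs]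
  have hdeg : (jacobiLift n α β).natDegree < 2 * n + 1 :=
    Nat.lt_succ_of_le (natDegree_jacobiLift_le n α β)
  rw [h3, aeval_eq_sum_range' hdeg, eval_eq_sum_range' hdeg]
  refine (norm_sum_le _ _).trans (Finset.sum_le_sum fun j _ => ?_)
  rw [norm_smul, norm_pow, hw1, one_pow, Real.norm_eq_abs,
    abs_of_nonneg (coeff_jacobiLift_nonneg n hs hd j)]

end EvenPart

/-! ### The limiting shape of the Fourier coefficients -/

section LimitCoefficients

open PowerSeries

/-- The coefficients of `(1 - X) ^ (-d)`. -/
noncomputable def binCoeff (d : ℝ) (k : ℕ) : ℝ := (ascPochhammer ℝ k).eval d / k.factorial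

lemma binCoeff_zero (d : ℝ) : binCoeff d 0 = 1 := by simp [binCoeff]

lemma binCoeff_succ (d : ℝ) (k : ℕ) : (k + 1) * binCoeff d (k + 1) = (k + d) * binCoeff d k := by
  unfold binCoeff
  rw [ascPochhammer_succ_eval, Nat.factorial_succ]
  push_cast
  field_simp
  ring

lemma binCoeff_nonneg {d : ℝ} (hd : 0 ≤ d) (k : ℕ) : 0 ≤ binCoeff d k := by
  induction k with
  | zero => rw [binCoeff_zero]; norm_num
  | succ k ih =>
    have h := binCoeff_succ d k
    have : 0 ≤ ((k : ℝ) + 1) * binCoeff d (k + 1) := by rw [h]; positivity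
    exact nonneg_of_mul_nonneg_right this (by positivity)

/-- The power series of `(1 - X ^ 2) ^ (-B)`. -/
noncomputable def evenSeries (B : ℝ) : PowerSeries ℝ :=
  PowerSeries.mk fun j => if j % 2 = 0 then binCoeff B (j / 2) else 0

/-- The coefficients of `(1 - X ^ 2) ^ (-B) * (1 - X) ^ (-d)`, which describe the first Fourier
coefficients of Jacobi polynomials in the limit `n → ∞`. -/
noncomputable def limCoeff (B d : ℝ) (j : ℕ) : ℝ :=
  PowerSeries.coeff j (evenSeries B * PowerSeries.mk (binCoeff d))

lemma limCoeff_eq_sum (B d : ℝ) (j : ℕ) : limCoeff B d j =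
    ∑ p ∈ Finset.HasAntidiagonal.antidiagonal j,
      (if p.1 % 2 = 0 then binCoeff B (p.1 / 2) else 0) * binCoeff d p.2 := by
  simp [limCoeff, evenSeries, PowerSeries.coeff_mul]

lemma limCoeff_zero (B d : ℝ) : limCoeff B d 0 = 1 := by
  simp [limCoeff_eq_sum, binCoeff_zero]

lemma limCoeff_one (B d : ℝ) : limCoeff B d 1 = d := by
  have := binCoeff_succ d 0
  simp [binCoeff_zero] at this
  simp [limCoeff_eq_sum, Finset.Nat.antidiagonal_succ, binCoeff_zero, this]

lemma limCoeff_nonneg {B d : ℝ} (hB : 0 ≤ B) (hd : 0 ≤ d) (j : ℕ) : 0 ≤ limCoeff B d j := by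
  rw [limCoeff_eq_sum]
  refine Finset.sum_nonneg fun p _ => mul_nonneg ?_ (binCoeff_nonneg hd _)
  split_ifs
  · exact binCoeff_nonneg hB _
  · exact le_rfl

/-- The limit of the recursion `coeff_jacobiLift_add_two` as `n → ∞`. It is the differential equation
`(1 - X ^ 2) f' = (2 * B * X + d * (1 + X)) f` of `f = (1 - X ^ 2) ^ (-B) * (1 - X) ^ (-d)`. -/
lemma limCoeff_add_two (B d : ℝ) (j : ℕ) :
    (j + 2) * limCoeff B d (j + 2) =
      d * limCoeff B d (j + 1) + (j + (2 * B + d)) * limCoeff B d j := by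
  set D : PowerSeries ℝ := PowerSeries.mk (binCoeff d) with hD
  have hX : ∀ (p : PowerSeries ℝ) (i : ℕ), coeff (i + 1) (X * p) = coeff i p :=
    fun p i => coeff_succ_X_mul i p
  have hc : ∀ p : PowerSeries ℝ, constantCoeff (derivative ℝ p) = coeff 1 p := fun p => by
    rw [← coeff_zero_eq_constantCoeff_apply, coeff_derivative]; simp
  have h1 : (1 - X) * derivative ℝ D = C d * D := by
    ext k
    cases k with
    | zero =>
      have := binCoeff_succ d 0
      simp [sub_mul, hc, hD] at this ⊢
      linarith
    | succ k =>
      have := binCoeff_succ d (k + 1)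
      rw [sub_mul, one_mul, map_sub, hX, coeff_C_mul, coeff_derivative, coeff_derivative, hD,
        coeff_mk, coeff_mk]
      push_cast at this ⊢
      linarith
  have h2 : (1 - X ^ 2) * derivative ℝ (evenSeries B) = C (2 * B) * (X * evenSeries B) := by
    ext k
    have hX2 : ∀ (p : PowerSeries ℝ) (i : ℕ), coeff (i + 2) (X ^ 2 * p) = coeff i p :=
      fun p i => by rw [pow_two, mul_assoc, hX, hX]
    match k with
    | 0 => simp [sub_mul, hc, evenSeries, pow_two, mul_assoc]
    | 1 =>
      have := binCoeff_succ B 0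
      rw [sub_mul, one_mul, map_sub, coeff_C_mul, pow_two, mul_assoc, hX _ 0, hX _ 0]
      simp [coeff_derivative, evenSeries, binCoeff_zero] at this ⊢
      linarith
    | k + 2 =>
      rw [sub_mul, one_mul, map_sub, hX2, coeff_C_mul, hX _ (k + 1), coeff_derivative,
        coeff_derivative]
      simp only [evenSeries, coeff_mk]
      rcases Nat.mod_two_eq_zero_or_one (k + 1) with hk | hk
      · obtain ⟨i, hi⟩ : ∃ i, k + 1 = 2 * i := ⟨(k + 1) / 2, by omega⟩
        have e1 : (k + 2 + 1) = 2 * (i + 1) := by omega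
        rw [e1, hi]
        simp only [Nat.mul_mod_right, if_true, Nat.mul_div_cancel_left _ (by norm_num : 0 < 2)]
        have := binCoeff_succ B i
        have hk' : (k : ℝ) + 1 = 2 * i := by exact_mod_cast hi
        push_cast
        rw [show (k : ℝ) + 2 + 1 = 2 * i + 2 by linarith, hk']
        linarith
      · rw [if_neg (by omega), if_neg (by omega)]
        simp
  have h3 : (1 - X ^ 2) * derivative ℝ (evenSeries B * D) =
      C (2 * B) * (X * (evenSeries B * D)) + C d * (evenSeries B * D)
        + C d * (X * (evenSeries B * D)) := by
    rw [Derivation.leibniz]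
    simp only [smul_eq_mul]
    linear_combination D * h2 + evenSeries B * (1 + X) * h1
  have h4 := congrArg (coeff (j + 1)) h3
  cases j with
  | zero =>
    rw [sub_mul, one_mul, map_sub, map_add, map_add, pow_two, mul_assoc, coeff_C_mul, coeff_C_mul,
      coeff_C_mul, hX _ 0, hX _ 0, coeff_derivative] at h4
    unfold limCoeff
    rw [← hD]
    simp at h4 ⊢
    linarith
  | succ j =>
    rw [sub_mul, one_mul, map_sub, map_add, map_add, pow_two, mul_assoc, coeff_C_mul, coeff_C_mul,
      coeff_C_mul, hX, hX, hX, coeff_derivative, coeff_derivative] at h4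
    unfold limCoeff
    push_cast at h4 ⊢
    linear_combination h4

end LimitCoefficients

/-! ### Comparison with the limiting shape -/

section Comparison

/-- With `α = B + d - 1 / 2` and `β = B - 1 / 2`, each step of the two recursions loses at most a
factor `1 - ε`, where `ε` is of the order of `J / n`. -/
lemma coeff_jacobiLift_ge_aux (n J : ℕ) {B d ε : ℝ} (hB : 0 ≤ B) (hd : 0 ≤ d) (hs : 0 < 2 * B + d)
    (hn : 1 ≤ n) (hJn : J ≤ n) (hε : ε * n = 2 * B + d + J) (hε1 : ε ≤ 1) (j : ℕ) (hj : j ≤ J) :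
    (1 - ε) ^ j * ((jacobiLift n (B + d - 1 / 2) (B - 1 / 2)).coeff 0 * limCoeff B d j) ≤
      (jacobiLift n (B + d - 1 / 2) (B - 1 / 2)).coeff j := by
  set α := B + d - 1 / 2 with hα
  set β := B - 1 / 2 with hβ
  set u := (jacobiLift n α β).coeff with hu
  have es : α + β + 1 = 2 * B + d := by rw [hα, hβ]; ring
  have ed : α - β = d := by rw [hα, hβ]; ring
  have hn' : (1 : ℝ) ≤ n := by exact_mod_cast hn
  have hJ' : (J : ℝ) ≤ n := by exact_mod_cast hJn
  have hε0 : 0 ≤ ε := by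
    by_contra h
    push Not at h
    have : ε * n < 0 := mul_neg_of_neg_of_pos h (by linarith)
    have : (0 : ℝ) ≤ J := J.cast_nonneg
    linarith
  have u0 : 0 < u 0 := coeff_jacobiLift_zero_pos n (by rw [es]; exact hs)
  induction j using Nat.strong_induction_on with
  | _ j ih =>
    match j with
    | 0 => simp [limCoeff_zero]
    | 1 =>
      have h := coeff_jacobiLift_one n α β
      rw [es, ed, ← hu] at h
      rw [limCoeff_one, pow_one]
      have hZ : 0 < 2 * (n : ℝ) - 1 + (2 * B + d) := by linarith
      refine le_of_mul_le_mul_right ?_ hZ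
      rw [h]
      have : (1 - ε) * (2 * (n : ℝ) - 1 + (2 * B + d)) ≤ 2 * n := by
        have : ε * n ≤ ε * (2 * (n : ℝ) - 1 + (2 * B + d)) := by gcongr; linarith
        have : (0 : ℝ) ≤ J := J.cast_nonneg
        linarith
      calc (1 - ε) * (u 0 * d) * (2 * (n : ℝ) - 1 + (2 * B + d))
          = (1 - ε) * (2 * (n : ℝ) - 1 + (2 * B + d)) * (u 0 * d) := by ring
        _ ≤ 2 * n * (u 0 * d) := by gcongr
        _ = _ := by ring
    | j + 2 =>
      have h := coeff_jacobiLift_add_two n α β j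
      rw [es, ed, ← hu] at h
      have i0 := ih j (by omega) (by omega)
      have i1 := ih (j + 1) (by omega) (by omega)
      have ha := limCoeff_add_two B d j
      have hjJ : (j : ℝ) + 2 ≤ J := by exact_mod_cast hj
      have hj0 : (0 : ℝ) ≤ j := j.cast_nonneg
      set Z := 2 * (n : ℝ) - j - 2 + (2 * B + d) with hZd
      have hZ : 0 < Z := by rw [hZd]; linarith
      have hεZ : 2 * B + d + J ≤ ε * Z := by
        rw [← hε]; gcongr; rw [hZd]; linarith
      have a0 := limCoeff_nonneg hB hd j
      have a1 := limCoeff_nonneg hB hd (j + 1)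
      have i0' : (1 - ε) ^ (j + 1) * (u 0 * limCoeff B d j) ≤ u j := by
        refine le_trans ?_ i0
        gcongr ?_ * _
        exact pow_le_pow_of_le_one (by linarith) (by linarith) (Nat.le_succ j)
      have hu0 : 0 ≤ u j := le_trans (by have : 0 ≤ 1 - ε := by linarith
                                         positivity) i0
      have hu1 : 0 ≤ u (j + 1) := le_trans (by have : 0 ≤ 1 - ε := by linarith
                                               positivity) i1
      have hp : 0 < ((j : ℝ) + 2) * Z := by positivity
      refine le_of_mul_le_mul_right ?_ hp
      rw [h]
      have b1 : (1 - ε) * Z ≤ 2 * (n - j - 1) := by rw [hZd] at hεZ ⊢; linarith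
      have b2 : (1 - ε) * Z ≤ 2 * n - j := by rw [hZd] at hεZ ⊢; linarith
      have hε1' : 0 ≤ 1 - ε := by linarith
      calc (1 - ε) ^ (j + 2) * (u 0 * limCoeff B d (j + 2)) * ((j + 2) * Z)
          = (1 - ε) * Z * ((1 - ε) ^ (j + 1) * (u 0 * ((j + 2) * limCoeff B d (j + 2)))) := by ring
        _ = (1 - ε) * Z * (d * ((1 - ε) ^ (j + 1) * (u 0 * limCoeff B d (j + 1)))
              + (j + (2 * B + d)) * ((1 - ε) ^ (j + 1) * (u 0 * limCoeff B d j))) := by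
            rw [ha]; ring
        _ ≤ (1 - ε) * Z * (d * u (j + 1) + (j + (2 * B + d)) * u j) := by gcongr
        _ = (1 - ε) * Z * (d * u (j + 1)) + (1 - ε) * Z * ((j + (2 * B + d)) * u j) := by ring
        _ ≤ 2 * (n - j - 1) * (d * u (j + 1)) + (2 * n - j) * ((j + (2 * B + d)) * u j) := by
            gcongr
        _ = _ := by ring

/-- The Fourier coefficients of a Jacobi polynomial dominate their limiting shape in the range
`j = O(√n)`. -/
lemma coeff_jacobiLift_ge (n J : ℕ) {B d : ℝ} (hB : 0 ≤ B) (hd : 0 ≤ d) (hs : 0 < 2 * B + d)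
    (hn : 1 ≤ n) (hJ : J * (2 * B + d + J) ≤ (n : ℝ) / 2) (j : ℕ) (hj : j ≤ J) :
    (jacobiLift n (B + d - 1 / 2) (B - 1 / 2)).coeff 0 * limCoeff B d j / 2 ≤
      (jacobiLift n (B + d - 1 / 2) (B - 1 / 2)).coeff j := by
  have hn' : (0 : ℝ) < n := by exact_mod_cast hn
  rcases Nat.eq_zero_or_pos J with rfl | hJ0
  · obtain rfl : j = 0 := by omega
    rw [limCoeff_zero, mul_one]
    have : 0 < (jacobiLift n (B + d - 1 / 2) (B - 1 / 2)).coeff 0 :=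
      coeff_jacobiLift_zero_pos n (by linarith)
    linarith
  have hJ1 : (1 : ℝ) ≤ J := by exact_mod_cast hJ0
  set ε := (2 * B + d + J) / (n : ℝ) with hεd
  have hε : ε * n = 2 * B + d + J := by rw [hεd]; field_simp
  have hJε : J * ε ≤ 1 / 2 := by
    rw [hεd, ← mul_div_assoc, div_le_iff₀ hn']; linarith
  have hε0 : 0 ≤ ε := by rw [hεd]; positivity
  have hε1 : ε ≤ 1 / 2 := by nlinarith
  have hJn : J ≤ n := by
    have : (J : ℝ) ≤ n := by nlinarith
    exact_mod_cast this
  have h := coeff_jacobiLift_ge_aux n J hB hd hs hn hJn hε (by linarith) j hj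
  refine le_trans ?_ h
  have hb := one_add_mul_le_pow (a := -ε) (by linarith) j
  have hjJ : (j : ℝ) ≤ J := by exact_mod_cast hj
  have : (1 : ℝ) / 2 ≤ (1 - ε) ^ j := by
    rw [← sub_eq_add_neg] at hb
    have : j * ε ≤ J * ε := by gcongr
    linarith
  have hu : 0 ≤ (jacobiLift n (B + d - 1 / 2) (B - 1 / 2)).coeff 0 * limCoeff B d j :=
    mul_nonneg (coeff_jacobiLift_zero_pos n (by linarith)).le (limCoeff_nonneg hB hd j)
  nlinarith

end Comparison

/-! ### Growth of Jacobi polynomials to the right of `1` -/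

section Growth

open Filter Topology

lemma ascPochhammer_eval_eq_prod (s : ℝ) (k : ℕ) :
    (ascPochhammer ℝ k).eval s = ∏ j ∈ Finset.range k, (s + j) := by
  induction k with
  | zero => simp
  | succ k ih => rw [ascPochhammer_succ_eval, Finset.prod_range_succ, ih]

/-- The coefficients of `(1 - X) ^ (-s)` grow like `k ^ (s - 1)`. -/
lemma exists_le_binCoeff {s : ℝ} (hs : 0 < s) :
    ∃ c : ℝ, 0 < c ∧ ∀ k : ℕ, c * (k + 1 : ℝ) ^ (s - 1) ≤ binCoeff s k := by
  obtain ⟨C, hC⟩ := (Real.GammaSeq_tendsto_Gamma s).bddAbove_range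
  set C' := max C 1 with hC'
  have hC0 : 0 < C' := lt_of_lt_of_le one_pos (le_max_right _ _)
  have hlow : ∀ k : ℕ, 1 ≤ k → (k : ℝ) ^ (s - 1) / (C' * (s + 1)) ≤ binCoeff s k := by
    intro k hk
    have hk' : (1 : ℝ) ≤ k := by exact_mod_cast hk
    have h1 : Real.GammaSeq s k ≤ C' := (hC ⟨k, rfl⟩).trans (le_max_left _ _)
    have hpos : 0 < ∏ j ∈ Finset.range k, (s + j) := Finset.prod_pos fun j _ => by positivity
    rw [Real.GammaSeq, Finset.prod_range_succ, div_le_iff₀ (by positivity)] at h1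
    rw [binCoeff, ascPochhammer_eval_eq_prod, div_le_div_iff₀ (by positivity) (by positivity)]
    have h2 : (k : ℝ) ^ s = k ^ (s - 1) * k := by
      rw [← Real.rpow_add_one (by positivity)]; congr 1; ring
    have h3 : s + k ≤ (s + 1) * k := by nlinarith
    have h4 : (k : ℝ) * (k ^ (s - 1) * k.factorial) ≤
        k * ((∏ j ∈ Finset.range k, (s + j)) * (C' * (s + 1))) := by
      calc (k : ℝ) * (k ^ (s - 1) * k.factorial) = (k : ℝ) ^ s * k.factorial := by rw [h2]; ring
        _ ≤ C' * ((∏ j ∈ Finset.range k, (s + j)) * (s + k)) := h1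
        _ ≤ C' * ((∏ j ∈ Finset.range k, (s + j)) * ((s + 1) * k)) := by gcongr
        _ = _ := by ring
    exact le_of_mul_le_mul_left h4 (by positivity)
  set c₀ := min 1 ((2 : ℝ) ^ (-|s - 1|) / (C' * (s + 1))) with hc₀
  refine ⟨c₀, by positivity, fun k => ?_⟩
  rcases Nat.eq_zero_or_pos k with rfl | hk
  · simp [binCoeff_zero, hc₀]
  · refine le_trans ?_ (hlow k hk)
    have hk' : (1 : ℝ) ≤ k := by exact_mod_cast hk
    have h5 : (2 : ℝ) ^ (-|s - 1|) * (k + 1 : ℝ) ^ (s - 1) ≤ (k : ℝ) ^ (s - 1) := by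
      rcases le_total 1 s with h | h
      · rw [abs_of_nonneg (by linarith)]
        have : ((k : ℝ) + 1) ^ (s - 1) ≤ (2 * k) ^ (s - 1) :=
          Real.rpow_le_rpow (by positivity) (by linarith) (by linarith)
        rw [Real.mul_rpow (by norm_num) (by positivity)] at this
        calc _ ≤ (2 : ℝ) ^ (-(s - 1)) * (2 ^ (s - 1) * (k : ℝ) ^ (s - 1)) := by gcongr
          _ = _ := by rw [← mul_assoc, ← Real.rpow_add (by norm_num)]; simp
      · have h6 : (2 : ℝ) ^ (-|s - 1|) ≤ 1 :=
          Real.rpow_le_one_of_one_le_of_nonpos (by norm_num) (by simp)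
        have h7 : ((k : ℝ) + 1) ^ (s - 1) ≤ (k : ℝ) ^ (s - 1) :=
          Real.rpow_le_rpow_of_nonpos (by positivity) (by linarith) (by linarith)
        calc _ ≤ 1 * ((k : ℝ) + 1) ^ (s - 1) := by gcongr
          _ ≤ _ := by rwa [one_mul]
    calc c₀ * (k + 1 : ℝ) ^ (s - 1)
        ≤ ((2 : ℝ) ^ (-|s - 1|) / (C' * (s + 1))) * (k + 1 : ℝ) ^ (s - 1) := by
          gcongr; exact min_le_right _ _
      _ = ((2 : ℝ) ^ (-|s - 1|) * (k + 1 : ℝ) ^ (s - 1)) / (C' * (s + 1)) := by ring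
      _ ≤ _ := by gcongr

/-- A truncation of `∑ (k + 1) ^ (s - 1) z ^ k` at `M ≥ 1 / (1 - z)` is already of the size
`(1 - z) ^ (-s)` of the full series: the terms with `k` of the order of `1 / (1 - z)` suffice. -/
lemma exists_le_truncated_sum (s : ℝ) :
    ∃ c : ℝ, 0 < c ∧ ∀ (M : ℕ) (z : ℝ), 1 / 2 ≤ z → z < 1 → 1 ≤ M * (1 - z) →
      c * (1 - z) ^ (-s) ≤ ∑ k ∈ Finset.range (M + 1), (k + 1 : ℝ) ^ (s - 1) * z ^ k := by
  refine ⟨(4 : ℝ) ^ (-|s - 1|) * Real.exp (-2) / 4, by positivity, fun M z hz hz1 hM => ?_⟩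
  have hz0 : 0 < 1 - z := by linarith
  set Y := 1 / (1 - z) with hY
  have hY2 : 2 ≤ Y := by rw [hY, le_div_iff₀ hz0]; linarith
  have hYz : Y * (1 - z) = 1 := by rw [hY]; field_simp
  set N := ⌊Y⌋₊ with hN
  have hNY : (N : ℝ) ≤ Y := Nat.floor_le (by linarith)
  have hYN : Y < N + 1 := Nat.lt_floor_add_one Y
  have hN2 : 2 ≤ N := Nat.le_floor (by exact_mod_cast hY2)
  have hNM : N ≤ M := by
    have : (N : ℝ) ≤ M := by
      refine hNY.trans ?_
      rw [hY, div_le_iff₀ hz0]; exact hM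
    exact_mod_cast this
  have hterm : ∀ k ∈ Finset.Ico (N / 2) N,
      (4 : ℝ) ^ (-|s - 1|) * Y ^ (s - 1) * Real.exp (-2) ≤ (k + 1 : ℝ) ^ (s - 1) * z ^ k := by
    intro k hk
    rw [Finset.mem_Ico] at hk
    have hk1 : (k : ℝ) + 1 ≤ Y := by
      have : (k : ℝ) + 1 ≤ N := by exact_mod_cast hk.2
      linarith
    have hk2 : Y / 4 ≤ (k : ℝ) + 1 := by
      have : (N : ℝ) + 1 ≤ 2 * (k + 1) := by
        exact_mod_cast (by omega : N + 1 ≤ 2 * (k + 1))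
      linarith
    have h1 : (4 : ℝ) ^ (-|s - 1|) * Y ^ (s - 1) ≤ (k + 1 : ℝ) ^ (s - 1) := by
      rcases le_total 1 s with h | h
      · rw [abs_of_nonneg (by linarith), Real.rpow_neg (by norm_num), mul_comm, ← div_eq_mul_inv,
          ← Real.div_rpow (by linarith) (by norm_num)]
        exact Real.rpow_le_rpow (by linarith) hk2 (by linarith)
      · have h6 : (4 : ℝ) ^ (-|s - 1|) ≤ 1 :=
          Real.rpow_le_one_of_one_le_of_nonpos (by norm_num) (by simp)
        have h7 : Y ^ (s - 1) ≤ ((k : ℝ) + 1) ^ (s - 1) :=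
          Real.rpow_le_rpow_of_nonpos (by positivity) hk1 (by linarith)
        calc _ ≤ 1 * Y ^ (s - 1) := by gcongr
          _ ≤ _ := by rwa [one_mul]
    have h2 : Real.exp (-2) ≤ z ^ k := by
      -- `log z ≥ 1 - 1 / z ≥ -2 (1 - z)` and `k (1 - z) ≤ Y (1 - z) = 1`
      have hlog : -(2 * (1 - z)) ≤ Real.log z := by
        have h := Real.one_sub_inv_le_log_of_pos (show 0 < z by linarith)
        refine le_trans ?_ h
        have : z⁻¹ = 1 + (1 - z) * z⁻¹ := by
          have : z ≠ 0 := by linarith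
          field_simp; ring
        have h3 : z⁻¹ ≤ 2 := by
          rw [inv_le_comm₀ (by linarith) (by norm_num)]; linarith
        nlinarith
      rw [← Real.exp_log (show 0 < z by linarith), ← Real.exp_nat_mul]
      apply Real.exp_le_exp.2
      have hkY : (k : ℝ) * (1 - z) ≤ 1 :=
        (mul_le_mul_of_nonneg_right (by linarith : (k : ℝ) ≤ Y) hz0.le).trans hYz.le
      have hk0 : (0 : ℝ) ≤ k := k.cast_nonneg
      nlinarith
    calc _ ≤ (k + 1 : ℝ) ^ (s - 1) * Real.exp (-2) := by gcongr
      _ ≤ _ := by gcongr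
  have hsub : Finset.Ico (N / 2) N ⊆ Finset.range (M + 1) := by
    intro k hk
    rw [Finset.mem_Ico] at hk
    rw [Finset.mem_range]; omega
  have hcard : Y / 4 ≤ ((Finset.Ico (N / 2) N).card : ℝ) := by
    rw [Nat.card_Ico]
    have : (N : ℝ) ≤ 2 * (N - N / 2 : ℕ) := by exact_mod_cast (by omega : N ≤ 2 * (N - N / 2))
    have : (2 : ℝ) ≤ N := by exact_mod_cast hN2
    linarith
  calc (4 : ℝ) ^ (-|s - 1|) * Real.exp (-2) / 4 * (1 - z) ^ (-s)
      = Y / 4 * ((4 : ℝ) ^ (-|s - 1|) * Y ^ (s - 1) * Real.exp (-2)) := by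
        have : (1 - z) ^ (-s) = Y * Y ^ (s - 1) := by
          rw [mul_comm Y, ← Real.rpow_add_one (by positivity), sub_add_cancel, hY, one_div,
            Real.inv_rpow hz0.le, Real.rpow_neg hz0.le]
        rw [this]; ring
    _ ≤ (Finset.Ico (N / 2) N).card *
          ((4 : ℝ) ^ (-|s - 1|) * Y ^ (s - 1) * Real.exp (-2)) := by gcongr
    _ ≤ ∑ k ∈ Finset.Ico (N / 2) N, (k + 1 : ℝ) ^ (s - 1) * z ^ k := by
        rw [← nsmul_eq_mul]; exact Finset.card_nsmul_le_sum _ _ _ hterm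
    _ ≤ _ := by
        refine Finset.sum_le_sum_of_subset_of_nonneg hsub fun k _ _ => ?_
        have : 0 < z := by linarith
        positivity

lemma exists_le_truncated_binomial_sum {B : ℝ} (hB : 0 ≤ B) :
    ∃ c : ℝ, 0 < c ∧ ∀ (M : ℕ) (z : ℝ), 1 / 2 ≤ z → z < 1 → 1 ≤ M * (1 - z) →
      c * (1 - z) ^ (-B) ≤ ∑ k ∈ Finset.range (M + 1), binCoeff B k * z ^ k := by
  rcases hB.eq_or_lt with rfl | hB
  · refine ⟨1, one_pos, fun M z hz hz1 _ => ?_⟩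
    rw [neg_zero, Real.rpow_zero, one_mul]
    have : binCoeff 0 0 * z ^ 0 ≤ ∑ k ∈ Finset.range (M + 1), binCoeff 0 k * z ^ k :=
      Finset.single_le_sum (f := fun k => binCoeff 0 k * z ^ k)
        (fun k _ => mul_nonneg (binCoeff_nonneg le_rfl k) (pow_nonneg (by linarith) k)) (by simp)
    simpa [binCoeff_zero] using this
  · obtain ⟨c, hc, h⟩ := exists_le_binCoeff hB
    obtain ⟨c', hc', h'⟩ := exists_le_truncated_sum B
    refine ⟨c * c', by positivity, fun M z hz hz1 hM => ?_⟩
    calc c * c' * (1 - z) ^ (-B) = c * (c' * (1 - z) ^ (-B)) := by ring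
      _ ≤ c * ∑ k ∈ Finset.range (M + 1), (k + 1 : ℝ) ^ (B - 1) * z ^ k := by
          gcongr; exact h' M z hz hz1 hM
      _ ≤ _ := by
          rw [Finset.mul_sum]
          refine Finset.sum_le_sum fun k _ => ?_
          rw [← mul_assoc]
          have : 0 ≤ z ^ k := pow_nonneg (by linarith) k
          gcongr; exact h k

/-- The terms of one parity of `∑ binCoeff d j * w ^ j`, truncated, are of the size of the full
series; here `z = w ^ 2`. -/
lemma exists_le_truncated_parity_sum {d : ℝ} (hd : 0 < d) :
    ∃ c : ℝ, 0 < c ∧ ∀ (e M : ℕ) (z : ℝ), e < 2 → 1 / 2 ≤ z → z < 1 → 1 ≤ M * (1 - z) →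
      c * (1 - z) ^ (-d) ≤ ∑ k ∈ Finset.range (M + 1), binCoeff d (2 * k + e) * z ^ k := by
  obtain ⟨c, hc, h⟩ := exists_le_binCoeff hd
  obtain ⟨c', hc', h'⟩ := exists_le_truncated_sum d
  refine ⟨c * (2 : ℝ) ^ (-|d - 1|) * c', by positivity, fun e M z he hz hz1 hM => ?_⟩
  have key : ∀ k : ℕ, c * (2 : ℝ) ^ (-|d - 1|) * (k + 1 : ℝ) ^ (d - 1) ≤
      binCoeff d (2 * k + e) := by
    intro k
    refine le_trans ?_ (h (2 * k + e))
    rw [mul_assoc]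
    refine mul_le_mul_of_nonneg_left ?_ hc.le
    have h1 : (k : ℝ) + 1 ≤ (2 * k + e : ℕ) + 1 := by exact_mod_cast (by omega)
    have h2 : ((2 * k + e : ℕ) : ℝ) + 1 ≤ 2 * (k + 1) := by exact_mod_cast (by omega)
    rcases le_total 1 d with hd1 | hd1
    · have h6 : (2 : ℝ) ^ (-|d - 1|) ≤ 1 :=
          Real.rpow_le_one_of_one_le_of_nonpos (by norm_num) (by simp)
      calc _ ≤ 1 * ((k : ℝ) + 1) ^ (d - 1) := by gcongr
        _ ≤ _ := by
          rw [one_mul]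
          exact Real.rpow_le_rpow (by positivity) h1 (by linarith)
    · have h7 : (2 * ((k : ℝ) + 1)) ^ (d - 1) ≤ (((2 * k + e : ℕ) : ℝ) + 1) ^ (d - 1) :=
        Real.rpow_le_rpow_of_nonpos (by positivity) h2 (by linarith)
      rw [Real.mul_rpow (by norm_num) (by positivity)] at h7
      rwa [abs_of_nonpos (by linarith), neg_neg]
  calc c * (2 : ℝ) ^ (-|d - 1|) * c' * (1 - z) ^ (-d)
      = c * (2 : ℝ) ^ (-|d - 1|) * (c' * (1 - z) ^ (-d)) := by ring
    _ ≤ c * (2 : ℝ) ^ (-|d - 1|) * ∑ k ∈ Finset.range (M + 1), (k + 1 : ℝ) ^ (d - 1) * z ^ k := by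
        gcongr; exact h' M z hz hz1 hM
    _ ≤ _ := by
        rw [Finset.mul_sum]
        refine Finset.sum_le_sum fun k _ => ?_
        rw [← mul_assoc]
        have : 0 ≤ z ^ k := pow_nonneg (by linarith) k
        gcongr; exact key k

/-- A product of truncations of `(1 - w ^ 2) ^ (-B)` and of the part of `(1 - w) ^ (-d)` of parity
`e` only involves monomials of the product series of degree at most `4 * M + 1`. -/
lemma truncated_product_le {B d : ℝ} (hB : 0 ≤ B) (hd : 0 ≤ d) (e M : ℕ) (he : e < 2) {w : ℝ}
    (hw : 0 ≤ w) :
    (∑ i ∈ Finset.range (M + 1), binCoeff B i * (w ^ 2) ^ i) *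
        (w ^ e * ∑ k ∈ Finset.range (M + 1), binCoeff d (2 * k + e) * (w ^ 2) ^ k) ≤
      ∑ j ∈ (Finset.range (4 * M + 2)).filter (fun j => j % 2 = e), limCoeff B d j * w ^ j := by
  set R := Finset.range (M + 1)
  have h1 : (∑ i ∈ R, binCoeff B i * (w ^ 2) ^ i) *
      (w ^ e * ∑ k ∈ R, binCoeff d (2 * k + e) * (w ^ 2) ^ k) =
      ∑ p ∈ R ×ˢ R, binCoeff B p.1 * binCoeff d (2 * p.2 + e) * w ^ (2 * p.1 + (2 * p.2 + e)) := by
    rw [Finset.mul_sum, Finset.sum_mul_sum, ← Finset.sum_product']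
    refine Finset.sum_congr rfl fun p _ => ?_
    rw [← pow_mul, ← pow_mul, pow_add, pow_add]
    ring
  rw [h1, ← Finset.sum_fiberwise_of_maps_to
    (t := (Finset.range (4 * M + 2)).filter (fun j => j % 2 = e))
    (g := fun p : ℕ × ℕ => 2 * p.1 + (2 * p.2 + e))]
  · refine Finset.sum_le_sum fun j _ => ?_
    rw [limCoeff_eq_sum, Finset.sum_mul]
    set F : ℕ × ℕ → ℝ := fun p => (if p.1 % 2 = 0 then binCoeff B (p.1 / 2) else 0) *
      binCoeff d p.2 * w ^ j
    set φ : ℕ × ℕ → ℕ × ℕ := fun p => (2 * p.1, 2 * p.2 + e)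
    have hφ : Set.InjOn φ ((R ×ˢ R).filter (fun p => 2 * p.1 + (2 * p.2 + e) = j)) := by
      rintro ⟨a, b⟩ _ ⟨a', b'⟩ _ hab
      simp only [φ, Prod.mk.injEq] at hab ⊢
      omega
    calc _ = ∑ p ∈ (R ×ˢ R).filter (fun p => 2 * p.1 + (2 * p.2 + e) = j), F (φ p) := by
          refine Finset.sum_congr rfl fun p hp => ?_
          rw [Finset.mem_filter] at hp
          simp [F, φ, ← hp.2]
      _ = ∑ q ∈ ((R ×ˢ R).filter (fun p => 2 * p.1 + (2 * p.2 + e) = j)).image φ, F q :=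
          (Finset.sum_image hφ).symm
      _ ≤ _ := by
          refine Finset.sum_le_sum_of_subset_of_nonneg ?_ fun q _ _ => ?_
          · intro q hq
            obtain ⟨p, hp, rfl⟩ := Finset.mem_image.1 hq
            rw [Finset.mem_filter] at hp
            simpa [φ] using hp.2
          · refine mul_nonneg (mul_nonneg ?_ (binCoeff_nonneg hd _)) (pow_nonneg hw _)
            split_ifs
            · exact binCoeff_nonneg hB _
            · exact le_rfl
  · rintro ⟨a, b⟩ hp
    simp only [R, Finset.mem_product, Finset.mem_range] at hp
    simp only [Finset.mem_filter, Finset.mem_range]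
    omega

/-- Growth of the even part of a Jacobi polynomial to the right of `1`, with the sharp power of
`1 - w ^ 2`. -/
theorem exists_le_evenLift {B d : ℝ} (hB : 0 ≤ B) (hd : 0 < d) :
    ∃ c : ℝ, 0 < c ∧ ∀ (n M : ℕ) (w : ℝ), 1 ≤ n →
      (4 * M + 1 : ℝ) * (2 * B + d + (4 * M + 1)) ≤ n / 2 → 0 < w → 1 / 2 ≤ w ^ 2 → w ^ 2 < 1 →
      1 ≤ M * (1 - w ^ 2) →
      c / √n * (1 - w ^ 2) ^ (-(B + d)) ≤ evenLift n (B + d - 1 / 2) (B - 1 / 2) w := by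
  obtain ⟨c₁, hc₁, h₁⟩ := exists_le_truncated_binomial_sum hB
  obtain ⟨c₂, hc₂, h₂⟩ := exists_le_truncated_parity_sum hd
  refine ⟨c₁ * c₂ / 16, by positivity, fun n M w hn hM hw0 hw hw1 hMw => ?_⟩
  have hn' : (0 : ℝ) < n := by exact_mod_cast hn
  have hw2 : 1 / 2 ≤ w := by nlinarith
  have hwlt : w ≤ 1 := by nlinarith
  have he : n % 2 < 2 := Nat.mod_lt _ (by norm_num)
  have hz : 0 < 1 - w ^ 2 := by linarith
  set u := (jacobiLift n (B + d - 1 / 2) (B - 1 / 2)).coeff with hu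
  have hs : 0 < (B + d - 1 / 2) + (B - 1 / 2) + 1 := by linarith
  have hu0 : 1 / (4 * √n) ≤ u 0 := le_coeff_jacobiLift_zero n hn hs
  have hsq : 0 < √(n : ℝ) := Real.sqrt_pos.2 hn'
  have hM2n : 4 * M + 2 ≤ 2 * n + 1 := by
    have hM0 : (0 : ℝ) ≤ M := M.cast_nonneg
    have : (4 * (M : ℝ) + 2) ≤ 2 * n + 1 := by nlinarith
    exact_mod_cast this
  have hprod := truncated_product_le hB hd.le (n % 2) M he hw0.le
  have hlow : c₁ * (1 - w ^ 2) ^ (-B) * (1 / 2 * (c₂ * (1 - w ^ 2) ^ (-d))) ≤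
      ∑ j ∈ (Finset.range (4 * M + 2)).filter (fun j => j % 2 = n % 2), limCoeff B d j * w ^ j := by
    refine le_trans ?_ hprod
    have hwe : 1 / 2 ≤ w ^ (n % 2) := by
      rcases Nat.mod_two_eq_zero_or_one n with h | h <;> rw [h]
      · norm_num
      · rwa [pow_one]
    have g1 := h₁ M (w ^ 2) hw hw1 hMw
    have g2 := h₂ (n % 2) M (w ^ 2) he hw hw1 hMw
    have p1 : 0 ≤ c₂ * (1 - w ^ 2) ^ (-d) := by positivity
    have p2 : 0 ≤ c₁ * (1 - w ^ 2) ^ (-B) := by positivity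
    exact mul_le_mul g1 (mul_le_mul hwe g2 p1 (by positivity)) (by positivity) (p2.trans g1)
  have hrp : (1 - w ^ 2) ^ (-(B + d)) = (1 - w ^ 2) ^ (-B) * (1 - w ^ 2) ^ (-d) := by
    rw [← Real.rpow_add hz]; congr 1; ring
  calc c₁ * c₂ / 16 / √n * (1 - w ^ 2) ^ (-(B + d))
      = 1 / (4 * √n) / 2 *
          (c₁ * (1 - w ^ 2) ^ (-B) * (1 / 2 * (c₂ * (1 - w ^ 2) ^ (-d)))) := by
        rw [hrp]; field_simp; norm_num
    _ ≤ u 0 / 2 * ∑ j ∈ (Finset.range (4 * M + 2)).filter (fun j => j % 2 = n % 2),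
          limCoeff B d j * w ^ j := by
        have : 0 ≤ u 0 := le_trans (by positivity) hu0
        gcongr
    _ ≤ ∑ j ∈ (Finset.range (4 * M + 2)).filter (fun j => j % 2 = n % 2), u j * w ^ j := by
        rw [Finset.mul_sum]
        refine Finset.sum_le_sum fun j hj => ?_
        rw [Finset.mem_filter, Finset.mem_range] at hj
        have := coeff_jacobiLift_ge n (4 * M + 1) hB hd.le (by linarith) hn
          (by push_cast; exact hM) j (by omega)
        rw [← hu] at this
        rw [← mul_assoc]
        gcongr
        linarith
    _ ≤ _ := by
        refine Finset.sum_le_sum_of_subset_of_nonneg ?_ fun j _ _ =>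
          mul_nonneg (coeff_jacobiLift_nonneg n hs (by linarith) j) (by positivity)
        intro j hj
        rw [Finset.mem_filter, Finset.mem_range] at hj ⊢
        exact ⟨by omega, hj.2⟩

end Growth

/-! ### Lower bounds for the Gegenbauer integral -/

section Gegenbauer

open MeasureTheory Set

lemma intervalIntegrable_one_sub_rpow {μ : ℝ} (hμ : 0 < μ) (a b : ℝ) :
    IntervalIntegrable (fun t : ℝ => (1 - t) ^ (μ - 1)) volume a b := by
  have h := (intervalIntegral.intervalIntegrable_rpow' (a := 1 - a) (b := 1 - b)
    (show -1 < μ - 1 by linarith)).comp_sub_left 1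
  simpa using h

lemma intervalIntegrable_gegenbauer_weight {μ : ℝ} (hμ : 0 < μ) :
    IntervalIntegrable (fun t : ℝ => (1 - t ^ 2) ^ (μ - 1)) volume (-1) 1 := by
  have h01 : IntervalIntegrable (fun t : ℝ => (1 - t ^ 2) ^ (μ - 1)) volume 0 1 := by
    have h := (intervalIntegrable_one_sub_rpow hμ 0 1).mul_continuousOn
      (g := fun t : ℝ => (1 + t) ^ (μ - 1)) (by
        refine ContinuousOn.rpow_const (by fun_prop) fun t ht => Or.inl ?_
        rw [uIcc_of_le zero_le_one] at ht
        linarith [ht.1])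
    refine h.congr fun t ht => ?_
    rw [uIoc_of_le zero_le_one] at ht
    rw [← Real.mul_rpow (by linarith [ht.2]) (by linarith [ht.1])]
    ring_nf
  have h10 : IntervalIntegrable (fun t : ℝ => (1 - t ^ 2) ^ (μ - 1)) volume (-1) 0 := by
    have h := (h01.comp_sub_left 0).symm
    simpa using h
  exact h10.trans h01

/-- A lower bound for the Gegenbauer integral from lower bounds for the even part of the
integrand. -/
lemma exists_le_gegenbauerIntegral {μ : ℝ} (hμ : 0 ≤ μ) :
    ∃ c C : ℝ, 0 < c ∧ 0 ≤ C ∧ ∀ (f : ℝ → ℝ) (M U t₁ : ℝ), Continuous f → 0 ≤ M → 0 ≤ U →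
      0 ≤ t₁ → t₁ < 1 → (∀ t ∈ Icc (-1 : ℝ) 1, -U ≤ (f t + f (-t)) / 2) →
      (∀ t ∈ Icc t₁ 1, M ≤ (f t + f (-t)) / 2 + U) →
      c * M * (1 - t₁) ^ μ - C * U ≤ gegenbauerIntegral μ f := by
  rcases hμ.eq_or_lt with rfl | hμ
  · refine ⟨1, 1, one_pos, zero_le_one, fun f M U t₁ _ _ _ _ ht _ h => ?_⟩
    have := h 1 ⟨ht.le, le_rfl⟩
    simp [gegenbauerIntegral]
    linarith
  · set g : ℝ → ℝ := fun t => (1 - t ^ 2) ^ (μ - 1) with hg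
    have hgi := intervalIntegrable_gegenbauer_weight hμ
    have hg0 : ∀ t ∈ Icc (-1 : ℝ) 1, 0 ≤ g t := fun t ht =>
      Real.rpow_nonneg (by nlinarith [ht.1, ht.2]) _
    refine ⟨1 / (2 * μ), ∫ t in (-1 : ℝ)..1, g t, by positivity,
      intervalIntegral.integral_nonneg (by norm_num) hg0,
      fun f M U t₁ hf hM hU ht0 ht1 h1 h2 => ?_⟩
    rw [gegenbauerIntegral, if_neg hμ.ne']
    have hi : ∀ k : ℝ → ℝ, Continuous k →
        IntervalIntegrable (fun t => k t * g t) volume (-1) 1 := fun k hk =>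
      hgi.continuousOn_mul hk.continuousOn
    have hrefl : ∫ t in (-1 : ℝ)..1, f (-t) * g t = ∫ t in (-1 : ℝ)..1, f t * g t := by
      have := intervalIntegral.integral_comp_neg (a := (-1 : ℝ)) (b := 1) (fun t => f t * g t)
      simpa [hg] using this
    have hkcont : Continuous fun t => (f t + f (-t)) / 2 + U := by fun_prop
    have hk := hi _ hkcont
    have hsum : ∫ t in (-1 : ℝ)..1, ((f t + f (-t)) / 2 + U) * g t =
        (∫ t in (-1 : ℝ)..1, f t * g t) + (∫ t in (-1 : ℝ)..1, g t) * U := by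
      have e : ∀ t, ((f t + f (-t)) / 2 + U) * g t =
          (1 / 2 * (f t * g t) + 1 / 2 * (f (-t) * g t)) + U * g t := fun t => by ring
      have i1 := (hi f hf).const_mul (1 / 2)
      have i2 := (hi (fun t => f (-t)) (by fun_prop)).const_mul (1 / 2)
      simp only [e]
      rw [intervalIntegral.integral_add (i1.add i2) (hgi.const_mul U),
        intervalIntegral.integral_add i1 i2, intervalIntegral.integral_const_mul,
        intervalIntegral.integral_const_mul, intervalIntegral.integral_const_mul, hrefl]
      ring
    have hs1 : uIcc (-1 : ℝ) t₁ ⊆ uIcc (-1) 1 := by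
      rw [uIcc_of_le (by linarith), uIcc_of_le (by norm_num)]
      exact Icc_subset_Icc le_rfl ht1.le
    have hs2 : uIcc t₁ 1 ⊆ uIcc (-1 : ℝ) 1 := by
      rw [uIcc_of_le ht1.le, uIcc_of_le (by norm_num)]
      exact Icc_subset_Icc (by linarith) le_rfl
    have hsplit := intervalIntegral.integral_add_adjacent_intervals (hk.mono_set hs1)
      (hk.mono_set hs2)
    have hA : 0 ≤ ∫ t in (-1 : ℝ)..t₁, ((f t + f (-t)) / 2 + U) * g t := by
      refine intervalIntegral.integral_nonneg (by linarith) fun t ht => ?_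
      have ht' : t ∈ Icc (-1 : ℝ) 1 := ⟨ht.1, ht.2.trans ht1.le⟩
      exact mul_nonneg (by linarith [h1 t ht']) (hg0 t ht')
    have hB : M * (1 / 2 * ((1 - t₁) ^ μ / μ)) ≤
        ∫ t in t₁..1, ((f t + f (-t)) / 2 + U) * g t := by
      have hval : ∫ t in t₁..1, (1 - t) ^ (μ - 1) = (1 - t₁) ^ μ / μ := by
        rw [intervalIntegral.integral_comp_sub_left (fun x => x ^ (μ - 1)) 1,
          integral_rpow (Or.inl (by linarith))]
        simp [hμ.ne']
      rw [← hval, ← intervalIntegral.integral_const_mul, ← intervalIntegral.integral_const_mul]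
      refine intervalIntegral.integral_mono_on_of_le_Ioo ht1.le
        (((intervalIntegrable_one_sub_rpow hμ _ _).const_mul _).const_mul _) (hk.mono_set hs2)
        fun t ht => ?_
      have ht' : t ∈ Icc t₁ 1 := ⟨ht.1.le, ht.2.le⟩
      have htt : t ∈ Icc (-1 : ℝ) 1 := ⟨by linarith [ht.1], ht.2.le⟩
      have hgt : 1 / 2 * (1 - t) ^ (μ - 1) ≤ g t := by
        have e1 : 1 - t ^ 2 = (1 - t) * (1 + t) := by ring
        have ht0' : 0 ≤ t := by linarith [ht.1]
        simp only [hg]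
        rw [e1, Real.mul_rpow (by linarith [ht.2]) (by linarith), mul_comm]
        refine mul_le_mul_of_nonneg_left ?_ (Real.rpow_nonneg (by linarith [ht.2]) _)
        rcases le_total 1 μ with h | h
        · exact le_trans (by norm_num) (Real.one_le_rpow (by linarith) (by linarith))
        · calc (1 / 2 : ℝ) = 2 ^ (-1 : ℝ) := by rw [Real.rpow_neg_one]; norm_num
            _ ≤ 2 ^ (μ - 1) := Real.rpow_le_rpow_of_exponent_le (by norm_num) (by linarith)
            _ ≤ _ := Real.rpow_le_rpow_of_nonpos (by linarith) (by linarith [ht.2]) (by linarith)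
      have := h2 t ht'
      exact mul_le_mul this hgt (mul_nonneg (by norm_num)
        (Real.rpow_nonneg (by linarith [ht.2]) _)) (by linarith)
    have e : 1 / (2 * μ) * M * (1 - t₁) ^ μ = M * (1 / 2 * ((1 - t₁) ^ μ / μ)) := by
      field_simp
    rw [e]
    linarith

/-- The Joukowski map `v ↦ (v + v⁻¹) / 2` sends `[w, v₁]` onto `[(v₁ + v₁⁻¹) / 2, (w + w⁻¹) / 2]`. -/
lemma exists_joukowski {w v₁ x : ℝ} (hw : 0 < w) (hwv : w ≤ v₁) (h1 : (v₁ + v₁⁻¹) / 2 ≤ x)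
    (h2 : x ≤ (w + w⁻¹) / 2) : ∃ v ∈ Icc w v₁, (v + v⁻¹) / 2 = x := by
  have hc : ContinuousOn (fun v : ℝ => (v + v⁻¹) / 2) (Icc w v₁) := by
    refine ContinuousOn.div_const (continuousOn_id.add (continuousOn_id.inv₀ fun v hv => ?_)) 2
    exact (lt_of_lt_of_le hw hv.1).ne'
  exact intermediate_value_Icc' hwv hc ⟨h1, h2⟩

/-- The even part of the Jacobi polynomial at a point of `[1, ∞)`, in the variable `v`. -/
lemma even_part_eq (n : ℕ) (α β : ℝ) {v : ℝ} (hv : 0 < v) :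
    ((jacobiP n α β).eval ((v + v⁻¹) / 2) + (jacobiP n α β).eval (-((v + v⁻¹) / 2))) / 2 =
      evenLift n α β v / v ^ n := by
  rw [evenLift_eq n α β hv.ne', mul_div_cancel_left₀ _ (pow_pos hv n).ne']

lemma one_le_joukowski {v : ℝ} (hv : 0 < v) : 1 ≤ (v + v⁻¹) / 2 := by
  have : v * v⁻¹ = 1 := mul_inv_cancel₀ hv.ne'
  have h2 : 0 < v⁻¹ := inv_pos.2 hv
  nlinarith [sq_nonneg (v - v⁻¹)]

/-- The even part of the Jacobi polynomial is bounded on `[-1, 1]` and nonnegative outside, hence bounded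
below on the whole line. -/
lemma neg_le_even_part (n : ℕ) {α β : ℝ} (hs : 0 < α + β + 1) (hd : β ≤ α) (x : ℝ) :
    -(jacobiLift n α β).eval 1 ≤ ((jacobiP n α β).eval x + (jacobiP n α β).eval (-x)) / 2 := by
  have hU : 0 ≤ (jacobiLift n α β).eval 1 :=
    (abs_nonneg _).trans (abs_eval_jacobiP_le n hs hd (x := 0) (by simp))
  wlog hx0 : 0 ≤ x generalizing x
  · have := this (-x) (by linarith)
    rw [neg_neg] at this
    linarith
  rcases le_total x 1 with hx | hx
  · have h1 := (abs_le.1 (abs_eval_jacobiP_le n hs hd (abs_le.2 ⟨by linarith, hx⟩))).1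
    have h2 := (abs_le.1 (abs_eval_jacobiP_le n hs hd (x := -x)
      (by rw [abs_neg]; exact abs_le.2 ⟨by linarith, hx⟩))).1
    linarith
  · have hw : 0 < 1 / (2 * x) := by positivity
    obtain ⟨v, hv, rfl⟩ := exists_joukowski (x := x) hw (v₁ := 1)
      (by rw [div_le_one (by positivity)]; linarith) (by simpa using hx)
      (by rw [one_div, inv_inv]; have : 0 ≤ (2 * x)⁻¹ := by positivity
          linarith)
    have hv0 : 0 < v := lt_of_lt_of_le hw hv.1
    rw [even_part_eq n α β hv0]
    have := evenLift_nonneg n hs hd hv0.le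
    have : 0 ≤ evenLift n α β v / v ^ n := by positivity
    linarith

/-- For `v₁ = w * (1 + 1 / n)`, the parameter `t₁` at which `t₁ * (w + w⁻¹) = v₁ + v₁⁻¹` has
distance at least a multiple of `(1 - w ^ 2) / n` to `1`. -/
lemma joukowski_gap {n : ℕ} {w : ℝ} (hn : 1 ≤ n) (hw0 : 0 < w) (hw1 : w < 1) (hw2 : 1 / 2 ≤ w ^ 2)
    (hv1 : w * (1 + 1 / n) ≤ 1) :
    (1 - w ^ 2) / (12 * n) ≤
      1 - ((w * (1 + 1 / n) + (w * (1 + 1 / n))⁻¹) / 2) / ((w + w⁻¹) / 2) := by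
  have hn' : (0 : ℝ) < n := by exact_mod_cast hn
  have hv0 : 0 < w * (1 + 1 / n) := by positivity
  set y := (w + w⁻¹) / 2 with hy
  set v₁ := w * (1 + 1 / n) with hv₁
  set x₁ := (v₁ + v₁⁻¹) / 2 with hx₁
  have hy1 : 1 ≤ y := one_le_joukowski hw0
  have hy0 : 0 < y := by linarith
  have hwi : w⁻¹ ≤ 2 := by
    rw [inv_le_comm₀ hw0 (by norm_num)]; nlinarith
  have hy2 : y ≤ 3 / 2 := by rw [hy]; linarith
  have e1 : y - x₁ = (v₁ - w) * (w⁻¹ * v₁⁻¹ - 1) / 2 := by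
    rw [hy, hx₁]; field_simp; ring
  have e2 : v₁ - w = w / n := by rw [hv₁]; field_simp; ring
  have e3 : (1 - w ^ 2) / 2 ≤ w⁻¹ * v₁⁻¹ - 1 := by
    have g1 : 1 ≤ v₁⁻¹ := (one_le_inv₀ hv0).2 hv1
    have g2 : 0 < w⁻¹ := inv_pos.2 hw0
    have g3 : w * w⁻¹ = 1 := mul_inv_cancel₀ hw0.ne'
    nlinarith [sq_nonneg (1 - w)]
  have e4 : (1 : ℝ) / 2 / n ≤ w / n := by gcongr; nlinarith
  have e5 : (1 - w ^ 2) / (8 * n) ≤ y - x₁ := by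
    rw [e1, e2]
    calc (1 - w ^ 2) / (8 * n) = (1 / 2 / n) * ((1 - w ^ 2) / 2) / 2 := by
          field_simp; norm_num
      _ ≤ _ := by
        have : 0 ≤ (1 - w ^ 2) / 2 := by nlinarith
        gcongr
  rw [one_sub_div hy0.ne', le_div_iff₀ hy0]
  calc (1 - w ^ 2) / (12 * n) * y ≤ (1 - w ^ 2) / (12 * n) * (3 / 2) := by
        have : 0 ≤ (1 - w ^ 2) / (12 * n) := div_nonneg (by nlinarith) (by positivity)
        gcongr
    _ = (1 - w ^ 2) / (8 * n) := by field_simp; ring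
    _ ≤ _ := e5

/-- To the right of `1`, the Gegenbauer integral of a Jacobi polynomial is positive up to an error
which is small as soon as `w ^ n` is; its main contribution comes from `t` within a distance of
the order of `(1 - w ^ 2) / n` of `1`. -/
lemma exists_le_gegenbauerIntegral_jacobiP {μ : ℝ} (hμ : 0 ≤ μ) :
    ∃ c C : ℝ, 0 < c ∧ 0 ≤ C ∧ ∀ (n : ℕ) (α β w : ℝ), 1 ≤ n → 0 < α + β + 1 → β ≤ α → 0 < w →
      w < 1 →
      (-(C * (jacobiLift n α β).eval 1 * w ^ n) ≤
        w ^ n * gegenbauerIntegral μ (fun t => (jacobiP n α β).eval (t * ((w + w⁻¹) / 2)))) ∧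
      (1 / 2 ≤ w ^ 2 → 2 ≤ n * (1 - w ^ 2) →
        c * ((1 - w ^ 2) / n) ^ μ * evenLift n α β w - C * (jacobiLift n α β).eval 1 * w ^ n ≤
          w ^ n * gegenbauerIntegral μ
            (fun t => (jacobiP n α β).eval (t * ((w + w⁻¹) / 2)))) := by
  obtain ⟨c, C, hc, hC, h⟩ := exists_le_gegenbauerIntegral hμ
  refine ⟨c * Real.exp (-1) * (1 / 12) ^ μ, C, by positivity, hC,
    fun n α β w hn hs hd hw0 hw1 => ?_⟩
  set y := (w + w⁻¹) / 2 with hy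
  set U := (jacobiLift n α β).eval 1 with hU
  have hU0 : 0 ≤ U := (abs_nonneg _).trans (abs_eval_jacobiP_le n hs hd (x := 0) (by simp))
  have hwn : 0 < w ^ n := by positivity
  have hcont : Continuous fun t : ℝ => (jacobiP n α β).eval (t * y) :=
    (jacobiP n α β).continuous.comp (by fun_prop)
  have hneg : ∀ t ∈ Icc (-1 : ℝ) 1, -U ≤
      ((jacobiP n α β).eval (t * y) + (jacobiP n α β).eval (-t * y)) / 2 := fun t _ => by
    rw [neg_mul]; exact neg_le_even_part n hs hd _
  constructor
  · have h1 := h _ (M := 0) U (1 / 2) hcont le_rfl hU0 (by norm_num) (by norm_num) hneg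
      (fun t ht => by linarith [hneg t ⟨by linarith [ht.1], ht.2⟩])
    have h2 := mul_le_mul_of_nonneg_left h1 hwn.le
    linarith
  · intro hw2 hnw
    have hn' : (0 : ℝ) < n := by exact_mod_cast hn
    have hy1 : 1 ≤ y := one_le_joukowski hw0
    set v₁ := w * (1 + 1 / n) with hv₁
    have hwv : w ≤ v₁ := by
      rw [hv₁]; nlinarith [show 0 < 1 / (n : ℝ) by positivity]
    have hv0 : 0 < v₁ := by positivity
    have hv1 : v₁ ≤ 1 := by
      have : w / n ≤ 1 - w := by
        rw [div_le_iff₀ hn']; nlinarith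
      rw [hv₁, mul_add, mul_one, mul_one_div]; linarith
    set x₁ := (v₁ + v₁⁻¹) / 2 with hx₁
    have hx1 : 1 ≤ x₁ := one_le_joukowski hv0
    have hgap : (1 - w ^ 2) / (12 * n) ≤ 1 - x₁ / y := joukowski_gap hn hw0 hw1 hw2 hv1
    have hpos : 0 < (1 - w ^ 2) / (12 * n) := div_pos (by nlinarith) (by positivity)
    have hV0 := evenLift_nonneg n hs hd hw0.le
    have hmain : ∀ t ∈ Icc (x₁ / y) 1, Real.exp (-1) * (evenLift n α β w / w ^ n) ≤
        ((jacobiP n α β).eval (t * y) + (jacobiP n α β).eval (-t * y)) / 2 := by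
      intro t ht
      have hy0 : 0 < y := by linarith
      obtain ⟨v, hv, hvx⟩ := exists_joukowski (x := t * y) hw0 hwv
        ((div_le_iff₀ hy0).1 ht.1) (by have := ht.2; nlinarith)
      have hvp : 0 < v := lt_of_lt_of_le hw0 hv.1
      rw [neg_mul, ← hvx, even_part_eq n α β hvp]
      have hvn : v ^ n ≤ w ^ n * Real.exp 1 := by
        calc v ^ n ≤ v₁ ^ n := pow_le_pow_left₀ hvp.le hv.2 n
          _ = w ^ n * (1 + 1 / n) ^ n := by rw [hv₁, mul_pow]
          _ ≤ _ := by
            gcongr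
            calc (1 + 1 / (n : ℝ)) ^ n ≤ (Real.exp (1 / n)) ^ n := by
                  gcongr; rw [add_comm]; exact Real.add_one_le_exp _
              _ = Real.exp 1 := by
                  rw [← Real.exp_nat_mul, mul_one_div_cancel hn'.ne']
      calc Real.exp (-1) * (evenLift n α β w / w ^ n)
          = evenLift n α β w / (w ^ n * Real.exp 1) := by
            rw [Real.exp_neg]; field_simp
        _ ≤ evenLift n α β v / v ^ n :=
            div_le_div₀ (evenLift_nonneg n hs hd hvp.le)
              (evenLift_mono n hs hd hw0.le hv.1) (by positivity) hvn
    have h1 := h (fun t => (jacobiP n α β).eval (t * y))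
      (Real.exp (-1) * (evenLift n α β w / w ^ n)) U (x₁ / y) hcont (by positivity)
      hU0 (by positivity) (by linarith) hneg
      (fun t ht => le_add_of_le_of_nonneg (hmain t ht) hU0)
    have h2 : ((1 : ℝ) / 12) ^ μ * ((1 - w ^ 2) / n) ^ μ ≤ (1 - x₁ / y) ^ μ := by
      rw [← Real.mul_rpow (by norm_num) (div_nonneg (by nlinarith) hn'.le)]
      refine Real.rpow_le_rpow (mul_nonneg (by norm_num) (div_nonneg (by nlinarith) hn'.le)) ?_ hμ
      refine le_trans (le_of_eq ?_) hgap
      field_simp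
    calc _ = w ^ n * (c * (Real.exp (-1) * (evenLift n α β w / w ^ n)) *
              ((1 / 12) ^ μ * ((1 - w ^ 2) / n) ^ μ) - C * U) := by
          field_simp
      _ ≤ w ^ n * (c * (Real.exp (-1) * (evenLift n α β w / w ^ n)) * (1 - x₁ / y) ^ μ
            - C * U) := by
          gcongr
      _ ≤ _ := by gcongr

end Gegenbauer

/-! ### The Gegenbauer integral as a polynomial -/

section GegenbauerPolynomial

open Polynomial MeasureTheory

lemma natDegree_jacobiP_le (n : ℕ) (α β : ℝ) : (jacobiP n α β).natDegree ≤ n := by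
  unfold jacobiP
  refine natDegree_sum_le_of_forall_le _ _ fun k hk => ?_
  have hk' : k ≤ n := by simpa [Nat.lt_succ_iff] using hk
  refine (natDegree_C_mul_le _ _).trans (natDegree_pow_le.trans ?_)
  have h : natDegree (C (1 / 2 : ℝ) * (X - 1)) ≤ 1 :=
    (natDegree_C_mul_le _ _).trans natDegree_X_sub_one.le
  calc k * natDegree (C (1 / 2 : ℝ) * (X - 1)) ≤ k * 1 := Nat.mul_le_mul_left _ h
    _ ≤ n := by omega

/-- The `i`-th moment of the Gegenbauer integral. -/
noncomputable def gegenbauerMoment (μ : ℝ) (i : ℕ) : ℝ := gegenbauerIntegral μ (fun t => t ^ i)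

lemma gegenbauerMoment_odd (μ : ℝ) {i : ℕ} (hi : Odd i) : gegenbauerMoment μ i = 0 := by
  unfold gegenbauerMoment gegenbauerIntegral
  split_ifs with h
  · simp [hi.neg_one_pow]
  · have := intervalIntegral.integral_comp_neg (a := (-1 : ℝ)) (b := 1)
      (fun t => t ^ i * (1 - t ^ 2) ^ (μ - 1))
    simp only [hi.neg_pow, even_two.neg_pow, neg_neg, neg_mul,
      intervalIntegral.integral_neg] at this
    linarith

lemma gegenbauerMoment_even_pos {μ : ℝ} (hμ : 0 ≤ μ) {i : ℕ} (hi : Even i) :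
    0 < gegenbauerMoment μ i := by
  obtain ⟨c, C, hc, hC, h⟩ := exists_le_gegenbauerIntegral hμ
  have := h (fun t => t ^ i) ((1 / 2) ^ i) 0 (1 / 2) (by fun_prop) (by positivity) le_rfl
    (by norm_num) (by norm_num) (fun t _ => by
      rw [hi.neg_pow, neg_zero]; have := hi.pow_nonneg t; linarith) (fun t ht => by
      rw [hi.neg_pow]
      have := pow_le_pow_left₀ (by norm_num) ht.1 i
      linarith)
  refine lt_of_lt_of_le ?_ this
  rw [mul_zero, sub_zero]
  positivity

/-- The polynomial `y ↦ ∫ P_n^{(α,β)}(t y) (1 - t ^ 2) ^ (μ - 1) dt`. -/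
noncomputable def gegenbauerPoly (n : ℕ) (α β μ : ℝ) : ℝ[X] :=
  ∑ i ∈ Finset.range (n + 1), C ((jacobiP n α β).coeff i * gegenbauerMoment μ i) * X ^ i

lemma eval_gegenbauerPoly (n : ℕ) (α β : ℝ) {μ : ℝ} (hμ : 0 ≤ μ) (y : ℝ) :
    (gegenbauerPoly n α β μ).eval y =
      gegenbauerIntegral μ (fun t => (jacobiP n α β).eval (t * y)) := by
  have hdeg : (jacobiP n α β).natDegree < n + 1 := Nat.lt_succ_of_le (natDegree_jacobiP_le n α β)
  rw [gegenbauerPoly, eval_finsetSum]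
  simp only [eval_mul, eval_C, eval_pow, eval_X]
  simp only [eval_eq_sum_range' hdeg]
  unfold gegenbauerMoment gegenbauerIntegral
  rcases hμ.eq_or_lt with rfl | hμ
  · simp only [if_true]
    rw [← Finset.sum_add_distrib, Finset.sum_div]
    refine Finset.sum_congr rfl fun i _ => ?_
    rw [mul_pow, mul_pow]
    ring
  · simp only [if_neg hμ.ne']
    have e : ∀ t : ℝ, (∑ i ∈ Finset.range (n + 1), (jacobiP n α β).coeff i * (t * y) ^ i) *
        (1 - t ^ 2) ^ (μ - 1) = ∑ i ∈ Finset.range (n + 1), ((jacobiP n α β).coeff i * y ^ i) *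
          (t ^ i * (1 - t ^ 2) ^ (μ - 1)) := fun t => by
      rw [Finset.sum_mul]
      refine Finset.sum_congr rfl fun i _ => ?_
      rw [mul_pow]; ring
    simp only [e]
    rw [intervalIntegral.integral_finsetSum]
    · refine Finset.sum_congr rfl fun i _ => ?_
      rw [intervalIntegral.integral_const_mul]
      ring
    · intro i _
      exact ((intervalIntegrable_gegenbauer_weight hμ).continuousOn_mul
        (by fun_prop : ContinuousOn (fun t : ℝ => t ^ i) _)).const_mul _

lemma coeff_gegenbauerPoly (n : ℕ) (α β μ : ℝ) {i : ℕ} (hi : i ≤ n) :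
    (gegenbauerPoly n α β μ).coeff i = (jacobiP n α β).coeff i * gegenbauerMoment μ i := by
  rw [gegenbauerPoly, finsetSum_coeff]
  simp only [coeff_C_mul_X_pow]
  rw [Finset.sum_ite_eq, if_pos (by simpa [Nat.lt_succ_iff] using hi)]

lemma evenLift_pos (n : ℕ) (hn : 1 ≤ n) {α β : ℝ} (hs : 0 < α + β + 1) (hd : β < α) {w : ℝ}
    (hw : 0 < w) : 0 < evenLift n α β w := by
  have hpos : 0 < (jacobiLift n α β).coeff (n % 2) := by
    have h0 := coeff_jacobiLift_zero_pos n hs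
    rcases Nat.mod_two_eq_zero_or_one n with h | h <;> rw [h]
    · exact h0
    · have h1 := coeff_jacobiLift_one n α β
      have hn' : (1 : ℝ) ≤ n := by exact_mod_cast hn
      have hd' : 0 < α - β := by linarith
      have : 0 < (jacobiLift n α β).coeff 1 * (2 * n - 1 + (α + β + 1)) := by
        rw [h1]; positivity
      exact pos_of_mul_pos_left this (by linarith)
  refine lt_of_lt_of_le (mul_pos hpos (pow_pos hw (n % 2)))
    (Finset.single_le_sum (f := fun j => (jacobiLift n α β).coeff j * w ^ j) (fun j _ =>
      mul_nonneg (coeff_jacobiLift_nonneg n hs hd.le j) (pow_nonneg hw.le j)) ?_)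
  rw [Finset.mem_filter, Finset.mem_range]
  exact ⟨by omega, Nat.mod_mod _ _⟩

/-- The moments of even order do not vanish, so that the polynomial is zero only if the even part of
the Jacobi polynomial is, which is positive at `1` by `evenLift_pos`. -/
lemma gegenbauerPoly_ne_zero (n : ℕ) (hn : 1 ≤ n) {α β μ : ℝ} (hμ : 0 ≤ μ) (hs : 0 < α + β + 1)
    (hd : β < α) : gegenbauerPoly n α β μ ≠ 0 := by
  intro h0
  -- at `μ = 0` the polynomial is the even part of the Jacobi polynomial
  have h1 : gegenbauerPoly n α β 0 = 0 := by
    rw [gegenbauerPoly]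
    refine Finset.sum_eq_zero fun i hi => ?_
    have hi' : i ≤ n := by simpa [Nat.lt_succ_iff] using hi
    rcases Nat.even_or_odd i with he | ho
    · have h2 := coeff_gegenbauerPoly n α β μ hi'
      rw [h0, coeff_zero] at h2
      rcases mul_eq_zero.1 h2.symm with h3 | h3
      · rw [h3]; simp
      · exact absurd h3 (gegenbauerMoment_even_pos hμ he).ne'
    · rw [gegenbauerMoment_odd 0 ho]; simp
  have h2 := eval_gegenbauerPoly n α β le_rfl ((1 + 1⁻¹) / 2)
  have h3 := evenLift_eq n α β one_ne_zero
  have h4 := evenLift_pos n hn hs hd one_pos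
  rw [h1] at h2
  simp [gegenbauerIntegral] at h2 h3
  linarith

lemma eval_neg_gegenbauerPoly (n : ℕ) (α β μ y : ℝ) :
    (gegenbauerPoly n α β μ).eval (-y) = (gegenbauerPoly n α β μ).eval y := by
  rw [gegenbauerPoly, eval_finsetSum, eval_finsetSum]
  refine Finset.sum_congr rfl fun i _ => ?_
  rcases Nat.even_or_odd i with he | ho
  · simp [he.neg_pow]
  · simp [gegenbauerMoment_odd μ ho]

/-- The polynomial `w ^ n * gegenbauerPoly ((w + w⁻¹) / 2)`. -/
noncomputable def gegenbauerLift (n : ℕ) (α β μ : ℝ) : ℝ[X] :=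
  ∑ i ∈ Finset.range (n + 1),
    C ((jacobiP n α β).coeff i * gegenbauerMoment μ i / 2 ^ i) * ((X ^ 2 + 1) ^ i * X ^ (n - i))

lemma aeval_gegenbauerLift {K : Type*} [Field K] [CharZero K] [Algebra ℝ K] (n : ℕ) (α β μ : ℝ)
    {w : K} (hw : w ≠ 0) :
    aeval w (gegenbauerLift n α β μ) =
      w ^ n * aeval ((w + w⁻¹) / 2) (gegenbauerPoly n α β μ) := by
  unfold gegenbauerLift gegenbauerPoly
  rw [map_sum, map_sum, Finset.mul_sum]
  refine Finset.sum_congr rfl fun i hi => ?_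
  have hi' : i ≤ n := by simpa [Nat.lt_succ_iff] using hi
  obtain ⟨m, rfl⟩ := Nat.exists_eq_add_of_le hi'
  rw [Nat.add_sub_cancel_left]
  simp only [map_mul, map_pow, map_add, aeval_X, aeval_C, map_one, map_div₀, map_ofNat]
  have e : w + w⁻¹ = (w ^ 2 + 1) / w := by field_simp
  rw [e, div_pow, div_pow, pow_add]
  field_simp

lemma eval_gegenbauerLift (n : ℕ) (α β : ℝ) {μ : ℝ} (hμ : 0 ≤ μ) {w : ℝ} (hw : w ≠ 0) :
    (gegenbauerLift n α β μ).eval w = w ^ n *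
      gegenbauerIntegral μ (fun t => (jacobiP n α β).eval (t * ((w + w⁻¹) / 2))) := by
  rw [← eval_gegenbauerPoly n α β hμ]
  simpa [coe_aeval_eq_eval] using aeval_gegenbauerLift (K := ℝ) n α β μ hw

lemma eval_neg_gegenbauerLift (n : ℕ) (α β μ w : ℝ) :
    (gegenbauerLift n α β μ).eval (-w) = (-1) ^ n * (gegenbauerLift n α β μ).eval w := by
  rw [gegenbauerLift, eval_finsetSum, eval_finsetSum, Finset.mul_sum]
  refine Finset.sum_congr rfl fun i hi => ?_
  have hi' : i ≤ n := by simpa [Nat.lt_succ_iff] using hi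
  rcases Nat.even_or_odd i with he | ho
  · obtain ⟨m, rfl⟩ := Nat.exists_eq_add_of_le hi'
    rw [Nat.add_sub_cancel_left]
    simp only [eval_mul, eval_C, eval_pow, eval_add, eval_X, eval_one, even_two.neg_pow]
    rw [pow_add, he.neg_one_pow, neg_pow w]
    ring
  · simp [gegenbauerMoment_odd μ ho]

end GegenbauerPolynomial

/-! ### From the radius to the unit circle -/

section Contour

open MeasureTheory Set

/-- Cauchy's theorem for the upper half of the unit disc. -/
lemma norm_integral_le_upper_arc {f : ℂ → ℂ} {r : ℝ} (hr : 1 < r)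
    (hf : DifferentiableOn ℂ f (Metric.ball 0 r)) :
    ‖∫ x in (-1 : ℝ)..1, f x‖ ≤ ∫ θ in (0 : ℝ)..Real.pi, ‖f (Complex.exp (θ * Complex.I))‖ := by
  obtain ⟨g, hg⟩ := hf.isExactOn_ball
  have hmem : ∀ z : ℂ, ‖z‖ ≤ 1 → z ∈ Metric.ball (0 : ℂ) r := fun z hz => by
    rw [mem_ball_zero_iff]; linarith
  have hcont := hf.continuousOn
  have h1 : ∫ x in (-1 : ℝ)..1, f x = g 1 - g (-1) := by
    have := intervalIntegral.integral_eq_sub_of_hasDerivAt (a := (-1 : ℝ)) (b := 1)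
      (f := fun x : ℝ => g x) (f' := fun x : ℝ => f x) ?_ ?_
    · simpa using this
    · intro x hx
      rw [uIcc_of_le (by norm_num)] at hx
      refine (hg x (hmem _ ?_)).comp_ofReal
      rw [Complex.norm_real]; exact abs_le.2 ⟨hx.1, hx.2⟩
    · refine ContinuousOn.intervalIntegrable (hcont.comp (by fun_prop) fun x hx => ?_)
      rw [uIcc_of_le (by norm_num)] at hx
      refine hmem _ ?_
      rw [Complex.norm_real]; exact abs_le.2 ⟨hx.1, hx.2⟩
  have hcirc : Continuous fun θ : ℝ => Complex.exp (θ * Complex.I) := by fun_prop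
  have hcf : Continuous fun θ : ℝ => f (Complex.exp (θ * Complex.I)) :=
    hcont.comp_continuous hcirc fun θ => hmem _ (Complex.norm_exp_ofReal_mul_I θ).le
  have h2 : ∫ θ in (0 : ℝ)..Real.pi,
      f (Complex.exp (θ * Complex.I)) * (Complex.exp (θ * Complex.I) * Complex.I) =
        g (-1) - g 1 := by
    have := intervalIntegral.integral_eq_sub_of_hasDerivAt (a := (0 : ℝ)) (b := Real.pi)
      (f := fun θ : ℝ => g (Complex.exp (θ * Complex.I)))
      (f' := fun θ : ℝ =>
        f (Complex.exp (θ * Complex.I)) * (Complex.exp (θ * Complex.I) * Complex.I)) ?_ ?_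
    · simpa using this
    · intro θ _
      have e1 : HasDerivAt (fun t : ℝ => Complex.exp (t * Complex.I))
          (Complex.exp (θ * Complex.I) * Complex.I) θ := by
        have : HasDerivAt (fun z : ℂ => Complex.exp (z * Complex.I))
            (Complex.exp (θ * Complex.I) * Complex.I) (θ : ℂ) := by
          simpa using ((hasDerivAt_id (θ : ℂ)).mul_const Complex.I).cexp
        exact this.comp_ofReal
      exact (hg _ (hmem _ (Complex.norm_exp_ofReal_mul_I θ).le)).comp θ e1
    · exact (hcf.mul (hcirc.mul continuous_const)).intervalIntegrable _ _
  have h3 : ∫ x in (-1 : ℝ)..1, f x = -∫ θ in (0 : ℝ)..Real.pi,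
      f (Complex.exp (θ * Complex.I)) * (Complex.exp (θ * Complex.I) * Complex.I) := by
    rw [h1, h2]; ring
  rw [h3, norm_neg]
  refine (intervalIntegral.norm_integral_le_integral_norm Real.pi_pos.le).trans (le_of_eq ?_)
  refine intervalIntegral.integral_congr fun θ _ => ?_
  simp [Complex.norm_exp_ofReal_mul_I]

/-- The substitution `y = cos θ` in the integral to be estimated. -/
lemma integral_cos_substitution (G : ℝ → ℝ) (l μ : ℝ) :
    ∫ y in (0 : ℝ)..1, |G y| * |y| ^ (2 * μ) * (1 - y ^ 2) ^ (l - 1 / 2) =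
      ∫ θ in (0 : ℝ)..(Real.pi / 2),
        |G (Real.cos θ)| * |Real.cos θ| ^ (2 * μ) * |Real.sin θ| ^ (2 * l) := by
  have hpi := Real.pi_pos
  rw [intervalIntegral.integral_of_le zero_le_one, intervalIntegral.integral_of_le (by positivity),
    integral_Ioc_eq_integral_Ioo, integral_Ioc_eq_integral_Ioo]
  have himg : Real.cos '' Ioo 0 (Real.pi / 2) = Ioo 0 1 := by
    ext y
    constructor
    · rintro ⟨θ, hθ, rfl⟩
      refine ⟨Real.cos_pos_of_mem_Ioo ⟨by linarith [hθ.1], hθ.2⟩, ?_⟩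
      have := Real.cos_lt_cos_of_nonneg_of_le_pi_div_two le_rfl hθ.2.le hθ.1
      simpa using this
    · intro hy
      exact ⟨Real.arccos y, mem_Ioo.2 ⟨Real.arccos_pos.2 hy.2, Real.arccos_lt_pi_div_two.2 hy.1⟩,
        Real.cos_arccos (by linarith [hy.1]) hy.2.le⟩
  have hinj : InjOn Real.cos (Ioo 0 (Real.pi / 2)) :=
    Real.injOn_cos.mono fun θ hθ => mem_Icc.2 ⟨hθ.1.le, by linarith [hθ.2]⟩
  rw [← himg, integral_image_eq_integral_abs_deriv_smul measurableSet_Ioo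
    (fun θ _ => (Real.hasDerivAt_cos θ).hasDerivWithinAt) hinj]
  refine setIntegral_congr_fun measurableSet_Ioo fun θ hθ => ?_
  have hsin : 0 < Real.sin θ := Real.sin_pos_of_pos_of_lt_pi hθ.1 (by linarith [hθ.2])
  simp only [smul_eq_mul, abs_neg]
  rw [abs_of_pos hsin, ← Real.sin_sq, ← Real.rpow_natCast, ← Real.rpow_mul hsin.le]
  have : Real.sin θ ^ (2 * l) = Real.sin θ * Real.sin θ ^ ((2 : ℕ) * (l - 1 / 2)) := by
    rw [mul_comm (Real.sin θ), ← Real.rpow_add_one hsin.ne']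
    congr 1; push_cast; ring
  rw [this]; ring

lemma integral_even_eq_two_mul {f : ℝ → ℝ} {a : ℝ} (ha : 0 ≤ a) (hf : ContinuousOn f (Icc (-a) a))
    (he : ∀ x, f (-x) = f x) : ∫ x in -a..a, f x = 2 * ∫ x in 0..a, f x := by
  have h1 : IntervalIntegrable f volume (-a) 0 :=
    (hf.mono (Icc_subset_Icc le_rfl ha)).intervalIntegrable_of_Icc (by linarith)
  have h2 : IntervalIntegrable f volume 0 a :=
    (hf.mono (Icc_subset_Icc (by linarith) le_rfl)).intervalIntegrable_of_Icc ha
  rw [← intervalIntegral.integral_add_adjacent_intervals h1 h2]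
  have := intervalIntegral.integral_comp_neg (a := (0 : ℝ)) (b := a) f
  simp only [he, neg_zero] at this
  rw [← this]; ring

/-- The nonnegative weight against which the lifted polynomial is integrated over `(0, 1)`. It
extends analytically past the closed unit disc, and is dominated by
`|1 - w ^ 2| ^ (2 * l) * |1 + w ^ 2| ^ p` on the unit circle. -/
noncomputable def radialWeight (l η : ℝ) (K p : ℕ) (w : ℝ) : ℝ :=
  (1 - w ^ 2) ^ K * (1 + η - w ^ 2) ^ (2 * l - K) * (1 + w ^ 2) ^ p

/-- The integral to be estimated dominates the integral of the lifted polynomial over the radius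
`(0, 1)`: push the contour from the radius to the unit circle. -/
theorem integral_lift_le (n : ℕ) (α β : ℝ) {μ l η : ℝ} (K p : ℕ) (hμ : 0 ≤ μ) (hl : 0 ≤ l)
    (hη : 0 < η) (hK : 1 ≤ K) (hKl : 2 * l ≤ K) (hp : 2 * μ ≤ p) :
    ∫ w in (0 : ℝ)..1, w ^ (n % 2) * (gegenbauerLift n α β μ).eval w * radialWeight l η K p w ≤
      2 ^ (2 * l + p) * ∫ y in (0 : ℝ)..1,
          |gegenbauerIntegral μ (fun t => (jacobiP n α β).eval (t * y))|
            * |y| ^ (2 * μ) * (1 - y ^ 2) ^ (l - 1 / 2) := by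
  set H := gegenbauerLift n α β μ
  set G := gegenbauerPoly n α β μ
  set fr : ℝ → ℝ := fun w => w ^ (n % 2) * H.eval w * radialWeight l η K p w with hfr
  set f : ℂ → ℂ := fun w => w ^ (n % 2) * Polynomial.aeval w H *
    ((1 - w ^ 2) ^ K * (1 + η - w ^ 2) ^ ((2 * l - K : ℝ) : ℂ) * (1 + w ^ 2) ^ p) with hf
  have hball : ∀ w : ℂ, w ∈ Metric.ball (0 : ℂ) √(1 + η) → (1 + η - w ^ 2) ∈ Complex.slitPlane := by
    intro w hw
    left
    rw [mem_ball_zero_iff] at hw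
    have h1 : ‖w‖ ^ 2 < 1 + η := by
      have := pow_lt_pow_left₀ hw (norm_nonneg _) two_ne_zero
      rwa [Real.sq_sqrt (by linarith)] at this
    have h2 := Complex.re_le_norm (w ^ 2)
    rw [norm_pow] at h2
    simp only [Complex.sub_re, Complex.add_re, Complex.one_re, Complex.ofReal_re]
    linarith
  have hdiff : DifferentiableOn ℂ f (Metric.ball 0 √(1 + η)) := by
    have hHd : Differentiable ℂ fun w : ℂ => Polynomial.aeval w H :=
      Polynomial.differentiable_aeval H
    have hcp : DifferentiableOn ℂ (fun w : ℂ => (1 + η - w ^ 2) ^ ((2 * l - K : ℝ) : ℂ))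
        (Metric.ball 0 √(1 + η)) :=
      DifferentiableOn.cpow_const (by fun_prop) fun w hw => hball w hw
    refine DifferentiableOn.mul (by fun_prop) (DifferentiableOn.mul (DifferentiableOn.mul
      (by fun_prop) hcp) (by fun_prop))
  have hreal : ∀ x : ℝ, x ∈ Icc (-1 : ℝ) 1 → f x = (fr x : ℂ) := by
    intro x hx
    have hpos : 0 ≤ 1 + η - x ^ 2 := by nlinarith [hx.1, hx.2]
    have hH : Polynomial.aeval (x : ℂ) H = ((H.eval x : ℝ) : ℂ) := by
      have := Polynomial.aeval_algebraMap_apply ℂ x H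
      simpa [Polynomial.coe_aeval_eq_eval] using this
    simp only [hf, hfr, radialWeight, hH]
    push_cast
    rw [Complex.ofReal_cpow hpos]
    push_cast
    rfl
  have hfrc : ContinuousOn fr (Icc (-1) 1) := by
    have : ContinuousOn (fun w : ℝ => (1 + η - w ^ 2) ^ (2 * l - K)) (Icc (-1) 1) :=
      ContinuousOn.rpow_const (by fun_prop) fun w hw => Or.inl (by nlinarith [hw.1, hw.2])
    have hHc : Continuous fun w => H.eval w := H.continuous
    exact ContinuousOn.mul (by fun_prop) (ContinuousOn.mul (ContinuousOn.mul (by fun_prop) this)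
      (by fun_prop))
  have hfre : ∀ x, fr (-x) = fr x := by
    intro x
    have h2 : ((-1 : ℝ)) ^ (n % 2) * (-1) ^ n = 1 := by
      rcases Nat.even_or_odd n with h | h
      · rw [Nat.even_iff.1 h, h.neg_one_pow]; norm_num
      · rw [Nat.odd_iff.1 h, h.neg_one_pow]; norm_num
    simp only [hfr, radialWeight, even_two.neg_pow]
    rw [eval_neg_gegenbauerLift, neg_pow]
    linear_combination (x ^ (n % 2) * H.eval x *
      ((1 - x ^ 2) ^ K * (1 + η - x ^ 2) ^ (2 * l - K) * (1 + x ^ 2) ^ p)) * h2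
  have h1 : ‖∫ x in (-1 : ℝ)..1, f x‖ = |2 * ∫ x in (0 : ℝ)..1, fr x| := by
    rw [← integral_even_eq_two_mul zero_le_one hfrc hfre, ← Real.norm_eq_abs, ← Complex.norm_real,
      ← intervalIntegral.integral_ofReal]
    congr 1
    refine intervalIntegral.integral_congr fun x hx => ?_
    rw [uIcc_of_le (by norm_num)] at hx
    exact hreal x hx
  set Φ : ℝ → ℝ := fun θ =>
    |G.eval (Real.cos θ)| * |Real.cos θ| ^ (2 * μ) * |Real.sin θ| ^ (2 * l) with hΦ
  have hΦc : Continuous Φ := by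
    have hGc : Continuous fun w => G.eval w := G.continuous
    refine ((hGc.comp Real.continuous_cos).abs.mul ?_).mul ?_
    · exact Real.continuous_cos.abs.rpow_const fun _ => Or.inr (by linarith)
    · exact Real.continuous_sin.abs.rpow_const fun _ => Or.inr (by linarith)
  have hnorm : ∀ θ : ℝ, ‖f (Complex.exp (θ * Complex.I))‖ ≤ 2 ^ (2 * l + p) * Φ θ := by
    intro θ
    set w := Complex.exp (θ * Complex.I) with hw
    have hw1 : ‖w‖ = 1 := Complex.norm_exp_ofReal_mul_I θ
    have hw0 : w ≠ 0 := Complex.exp_ne_zero _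
    have hwi : w⁻¹ = Complex.exp (-θ * Complex.I) := by rw [hw, ← Complex.exp_neg, neg_mul]
    have hcos : w + w⁻¹ = ((2 * Real.cos θ : ℝ) : ℂ) := by
      rw [hwi, hw]; push_cast; rw [Complex.cos]; ring
    have hsin : w - w⁻¹ = ((2 * Real.sin θ : ℝ) : ℂ) * Complex.I := by
      rw [hwi, hw]; push_cast; rw [Complex.sin]
      linear_combination (-(Complex.exp (-θ * Complex.I) - Complex.exp (θ * Complex.I))) *
        Complex.I_sq
    have n1 : ‖1 - w ^ 2‖ = 2 * |Real.sin θ| := by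
      have : 1 - w ^ 2 = -(w * (w - w⁻¹)) := by field_simp; ring
      rw [this, norm_neg, norm_mul, hw1, hsin, norm_mul, Complex.norm_I, Complex.norm_real,
        Real.norm_eq_abs, abs_mul, abs_two]; ring
    have n2 : ‖1 + w ^ 2‖ = 2 * |Real.cos θ| := by
      have : 1 + w ^ 2 = w * (w + w⁻¹) := by field_simp; ring
      rw [this, norm_mul, hw1, hcos, Complex.norm_real,
        Real.norm_eq_abs, abs_mul, abs_two]; ring
    have n3 : ‖Polynomial.aeval w H‖ = |G.eval (Real.cos θ)| := by
      have e : (w + w⁻¹) / 2 = ((Real.cos θ : ℝ) : ℂ) := by rw [hcos]; push_cast; ring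
      have hG : Polynomial.aeval ((Real.cos θ : ℝ) : ℂ) G = ((G.eval (Real.cos θ) : ℝ) : ℂ) := by
        have := Polynomial.aeval_algebraMap_apply ℂ (Real.cos θ) G
        simpa [Polynomial.coe_aeval_eq_eval] using this
      rw [aeval_gegenbauerLift n α β μ hw0, e, hG, norm_mul, norm_pow, hw1, one_pow, one_mul,
        Complex.norm_real, Real.norm_eq_abs]
    -- moving the base point from `1` to `1 + η` only increases the distance to `w ^ 2`
    have n4 : ‖1 - w ^ 2‖ ≤ ‖1 + η - w ^ 2‖ := by
      have hre : (w ^ 2).re ≤ 1 := by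
        have := Complex.re_le_norm (w ^ 2)
        rwa [norm_pow, hw1, one_pow] at this
      rw [Complex.norm_def, Complex.norm_def]
      refine Real.sqrt_le_sqrt ?_
      rw [Complex.normSq_apply, Complex.normSq_apply]
      simp only [Complex.sub_re, Complex.add_re, Complex.one_re, Complex.ofReal_re, Complex.sub_im,
        Complex.add_im, Complex.one_im, Complex.ofReal_im, add_zero]
      nlinarith
    have n5 : ‖1 - w ^ 2‖ ^ K * ‖1 + η - w ^ 2‖ ^ (2 * l - K) ≤ (2 * |Real.sin θ|) ^ (2 * l) := by
      rcases (norm_nonneg (1 - w ^ 2)).eq_or_lt with h | h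
      · rw [← h, zero_pow (by omega), zero_mul]; positivity
      · calc _ ≤ ‖1 - w ^ 2‖ ^ K * ‖1 - w ^ 2‖ ^ (2 * l - K) := by
              gcongr ?_ * ?_
              exact Real.rpow_le_rpow_of_nonpos h n4 (by linarith)
          _ = ‖1 - w ^ 2‖ ^ (2 * l) := by
              rw [← Real.rpow_natCast, ← Real.rpow_add h]; congr 1; ring
          _ = _ := by rw [n1]
    have n6 : |Real.cos θ| ^ p ≤ |Real.cos θ| ^ (2 * μ) := by
      rcases (abs_nonneg (Real.cos θ)).eq_or_lt with h | h
      · rw [← h]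
        rcases Nat.eq_zero_or_pos p with rfl | hp0
        · have : μ = 0 := by push_cast at hp; linarith
          simp [this]
        · rw [zero_pow hp0.ne']; positivity
      · rw [← Real.rpow_natCast]
        exact Real.rpow_le_rpow_of_exponent_ge h (Real.abs_cos_le_one θ) hp
    simp only [hf, hΦ]
    rw [norm_mul, norm_mul, norm_mul, norm_mul, norm_pow, hw1, one_pow, one_mul, n3, norm_pow,
      norm_pow, n2, Complex.norm_cpow_real]
    calc _ ≤ |G.eval (Real.cos θ)| * ((2 * |Real.sin θ|) ^ (2 * l) *
            (2 ^ p * |Real.cos θ| ^ (2 * μ))) := by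
          rw [mul_pow]; gcongr
      _ = _ := by
          rw [Real.mul_rpow (by norm_num) (abs_nonneg _), Real.rpow_add (by norm_num),
            Real.rpow_natCast]
          ring
  have hr : 1 < √(1 + η) := by
    rw [Real.lt_sqrt (by norm_num)]; linarith
  have h2 := norm_integral_le_upper_arc hr hdiff
  have h3 : ∫ θ in (0 : ℝ)..Real.pi, ‖f (Complex.exp (θ * Complex.I))‖ ≤
      ∫ θ in (0 : ℝ)..Real.pi, 2 ^ (2 * l + p) * Φ θ := by
    refine intervalIntegral.integral_mono_on Real.pi_pos.le ?_
      ((continuous_const.mul hΦc).intervalIntegrable _ _) fun θ _ => hnorm θ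
    refine Continuous.intervalIntegrable (Continuous.norm ?_) _ _
    refine hdiff.continuousOn.comp_continuous (by fun_prop) fun θ => ?_
    rw [mem_ball_zero_iff, Complex.norm_exp_ofReal_mul_I]; exact hr
  have h4 : ∫ θ in (0 : ℝ)..Real.pi, Φ θ = 2 * ∫ θ in (0 : ℝ)..(Real.pi / 2), Φ θ := by
    rw [← intervalIntegral.integral_add_adjacent_intervals
      (hΦc.intervalIntegrable 0 (Real.pi / 2)) (hΦc.intervalIntegrable (Real.pi / 2) Real.pi)]
    have := intervalIntegral.integral_comp_sub_left (a := (0 : ℝ)) (b := Real.pi / 2) Φ Real.pi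
    have hsym : ∀ θ, Φ (Real.pi - θ) = Φ θ := fun θ => by
      simp only [hΦ, Real.cos_pi_sub, Real.sin_pi_sub, abs_neg, G, eval_neg_gegenbauerPoly]
    simp only [hsym, sub_zero] at this
    rw [show Real.pi - Real.pi / 2 = Real.pi / 2 by ring] at this
    rw [← this]; ring
  rw [integral_cos_substitution
    (fun y => gegenbauerIntegral μ (fun t => (jacobiP n α β).eval (t * y)))]
  simp only [← eval_gegenbauerPoly n α β hμ]
  rw [intervalIntegral.integral_const_mul, h4] at h3
  rw [h1] at h2
  have h5 := le_abs_self (2 * ∫ x in (0 : ℝ)..1, fr x)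
  have h6 : 2 * ∫ x in (0 : ℝ)..1, fr x ≤
      2 ^ (2 * l + p) * (2 * ∫ θ in (0 : ℝ)..(Real.pi / 2), Φ θ) := h5.trans (h2.trans h3)
  linarith

end Contour

/-! ### The radial weight, the radial integral and the error terms -/

section Estimates

open MeasureTheory Set Filter Topology

lemma radialWeight_nonneg (l : ℝ) {η : ℝ} (hη : 0 < η) (K p : ℕ) {w : ℝ} (hw : w ^ 2 ≤ 1) :
    0 ≤ radialWeight l η K p w := by
  unfold radialWeight
  have h1 : 0 ≤ 1 - w ^ 2 := by linarith
  have h2 : 0 ≤ 1 + η - w ^ 2 := by linarith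
  positivity

/-- For `1 - w ^ 2 ≥ η` the weight is comparable with `(1 - w ^ 2) ^ (2 * l)`. -/
lemma le_radialWeight {l η : ℝ} {K : ℕ} (p : ℕ) (hη : 0 < η) (hKl : 2 * l ≤ K) {w : ℝ}
    (hw : η ≤ 1 - w ^ 2) :
    2 ^ (2 * l - K) * (1 - w ^ 2) ^ (2 * l) ≤ radialWeight l η K p w := by
  unfold radialWeight
  have h0 : 0 < 1 - w ^ 2 := by linarith
  have h1 : (2 * (1 - w ^ 2)) ^ (2 * l - K) ≤ (1 + η - w ^ 2) ^ (2 * l - K) :=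
    Real.rpow_le_rpow_of_nonpos (by linarith) (by linarith) (by linarith)
  have h2 : (1 : ℝ) ≤ (1 + w ^ 2) ^ p := one_le_pow₀ (by nlinarith [sq_nonneg w])
  calc 2 ^ (2 * l - K) * (1 - w ^ 2) ^ (2 * l)
      = (1 - w ^ 2) ^ K * (2 * (1 - w ^ 2)) ^ (2 * l - K) * 1 := by
        rw [Real.mul_rpow (by norm_num) h0.le, mul_one, mul_left_comm,
          ← Real.rpow_natCast (1 - w ^ 2) K, ← Real.rpow_add h0]
        congr 2; ring
    _ ≤ _ := by
        have : 0 ≤ (1 - w ^ 2) ^ K * (1 + η - w ^ 2) ^ (2 * l - K) := by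
          have : 0 < 1 + η - w ^ 2 := by linarith
          positivity
        gcongr

/-- The product of the weight, with `η = x⁻¹` and `n = x ^ 4`, and of `w ^ n` is negligible: for
`1 - w ^ 2 ≤ η ^ 2` the weight is at most of the order of `η ^ K`, and for `1 - w ^ 2 ≥ η ^ 2` the
power `w ^ n` is at most `exp (-(x / 2))`. -/
lemma radialWeight_mul_pow_le {l x : ℝ} {K : ℕ} (p n : ℕ) (hl : 0 ≤ l) (hKl : 2 * l ≤ K)
    (hx : 1 ≤ x) (hn : (n : ℝ) = x ^ 4) {w : ℝ} (hw0 : 0 < w) (hw1 : w < 1) :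
    radialWeight l x⁻¹ K p w * w ^ n ≤ 2 ^ p * (x⁻¹ ^ K + Real.exp (-(x / 2))) := by
  set η := x⁻¹ with hη
  have hη0 : 0 < η := by positivity
  have hη1 : η ≤ 1 := inv_le_one_of_one_le₀ hx
  have hηx : η * x = 1 := by rw [hη]; field_simp
  set ρ := 1 - w ^ 2 with hρ
  have hρ0 : 0 < ρ := by rw [hρ]; nlinarith
  have hρ1 : ρ ≤ 1 := by rw [hρ]; nlinarith
  have e : 1 + η - w ^ 2 = ρ + η := by rw [hρ]; ring
  have hp : (1 + w ^ 2) ^ p ≤ 2 ^ p := pow_le_pow_left₀ (by positivity) (by nlinarith) p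
  have key : ρ ^ K * (ρ + η) ^ (2 * l - K) * w ^ n ≤ η ^ K + Real.exp (-(x / 2)) := by
    have hexp := Real.exp_pos (-(x / 2))
    rcases le_total ρ (η ^ 2) with h | h
    · have h1 : ρ ^ K ≤ η ^ K * η ^ K := by
        rw [← mul_pow, ← pow_two]; exact pow_le_pow_left₀ hρ0.le h K
      have h2 : η ^ K * (ρ + η) ^ (2 * l - K) ≤ 1 := by
        calc η ^ K * (ρ + η) ^ (2 * l - K) ≤ η ^ K * η ^ (2 * l - K) := by
              gcongr ?_ * ?_
              exact Real.rpow_le_rpow_of_nonpos hη0 (by linarith) (by linarith)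
          _ = η ^ (2 * l) := by
              rw [← Real.rpow_natCast, ← Real.rpow_add hη0]; congr 1; ring
          _ ≤ 1 := Real.rpow_le_one hη0.le hη1 (by linarith)
      have h3 : w ^ n ≤ 1 := pow_le_one₀ hw0.le hw1.le
      calc _ ≤ η ^ K * η ^ K * (ρ + η) ^ (2 * l - K) * 1 := by gcongr
        _ = η ^ K * (η ^ K * (ρ + η) ^ (2 * l - K)) := by ring
        _ ≤ η ^ K * 1 := by gcongr
        _ ≤ _ := by linarith
    · have h1 : ρ ^ K * (ρ + η) ^ (2 * l - K) ≤ 1 := by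
        calc ρ ^ K * (ρ + η) ^ (2 * l - K) ≤ ρ ^ K * ρ ^ (2 * l - K) := by
              gcongr ?_ * ?_
              exact Real.rpow_le_rpow_of_nonpos hρ0 (by linarith) (by linarith)
          _ = ρ ^ (2 * l) := by
              rw [← Real.rpow_natCast, ← Real.rpow_add hρ0]; congr 1; ring
          _ ≤ 1 := Real.rpow_le_one hρ0.le hρ1 (by linarith)
      have h2 : w ≤ Real.exp (-(η ^ 2 / 2)) := by
        have := Real.add_one_le_exp (-(η ^ 2))
        have e2 : Real.exp (-(η ^ 2)) = Real.exp (-(η ^ 2 / 2)) ^ 2 := by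
          rw [← Real.exp_nat_mul]; congr 1; push_cast; ring
        refine (abs_le_of_sq_le_sq' ?_ (Real.exp_pos _).le).2
        rw [← e2]; linarith
      have h3 : w ^ n ≤ Real.exp (-(x / 2)) := by
        calc w ^ n ≤ Real.exp (-(η ^ 2 / 2)) ^ n := pow_le_pow_left₀ hw0.le h2 n
          _ = Real.exp (-(x ^ 2 / 2)) := by
              rw [← Real.exp_nat_mul, hn]
              congr 1
              linear_combination (-(x ^ 2) * (η * x + 1) / 2) * hηx
          _ ≤ _ := Real.exp_le_exp.2 (by nlinarith)
      have hwn : 0 ≤ w ^ n := by positivity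
      calc _ ≤ 1 * Real.exp (-(x / 2)) := by gcongr
        _ ≤ _ := by have : 0 ≤ η ^ K := by positivity
                    linarith
  have hk0 : 0 ≤ ρ ^ K * (ρ + η) ^ (2 * l - K) * w ^ n := by positivity
  calc radialWeight l η K p w * w ^ n
      = (1 + w ^ 2) ^ p * (ρ ^ K * (ρ + η) ^ (2 * l - K) * w ^ n) := by
        rw [radialWeight, e]; ring
    _ ≤ _ := by gcongr

/-- The contribution of the radius, `∫ (1 - w ^ 2) ^ (l - δ - 1) w dw`, which is logarithmic
precisely in the critical case `δ = l`. -/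
lemma exists_le_integral_radius {l δ : ℝ} (hδ : δ ≤ l) :
    ∃ c : ℝ, 0 < c ∧ ∀ (n : ℕ) (x : ℝ), 4 ≤ x → (n : ℝ) = x ^ 4 →
      c * (if δ = l then Real.log n else 1) ≤
        ∫ w in √(1 / 2)..√(1 - x⁻¹), w * (1 - w ^ 2) ^ (l - δ - 1) := by
  have hsq : ∀ {x w : ℝ}, 4 ≤ x → w ∈ Icc √(1 / 2) √(1 - x⁻¹) →
      0 < w ∧ x⁻¹ ≤ 1 - w ^ 2 := by
    intro x w hx hw
    have hx1 : x⁻¹ ≤ 1 := inv_le_one_of_one_le₀ (by linarith)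
    have h0 : 0 < w := lt_of_lt_of_le (Real.sqrt_pos.2 (by norm_num)) hw.1
    have h1 := pow_le_pow_left₀ h0.le hw.2 2
    rw [Real.sq_sqrt (by linarith)] at h1
    exact ⟨h0, by linarith⟩
  have hcont : ∀ {x : ℝ}, 4 ≤ x →
      ContinuousOn (fun w : ℝ => w * (1 - w ^ 2) ^ (l - δ - 1)) (Icc √(1 / 2) √(1 - x⁻¹)) := by
    intro x hx
    refine continuousOn_id.mul (ContinuousOn.rpow_const (by fun_prop) fun w hw => Or.inl ?_)
    have := (hsq hx hw).2
    have : 0 < x⁻¹ := inv_pos.2 (by linarith)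
    linarith
  have hle : ∀ {x : ℝ}, 4 ≤ x → √(1 / 2) ≤ √(1 - x⁻¹) := fun {x} hx => by
    refine Real.sqrt_le_sqrt ?_
    have : x⁻¹ ≤ 4⁻¹ := inv_anti₀ (by norm_num) hx
    linarith
  rcases hδ.eq_or_lt with rfl | hlt
  · refine ⟨1 / 16, by norm_num, fun n x hx hn => ?_⟩
    rw [if_pos rfl]
    have hx0 : 0 < x := by linarith
    have h1 : ∫ w in √(1 / 2)..√(1 - x⁻¹), w * (1 - w ^ 2) ^ (δ - δ - 1) =
        -(1 / 2) * Real.log (1 - √(1 - x⁻¹) ^ 2) - -(1 / 2) * Real.log (1 - √(1 / 2) ^ 2) := by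
      refine intervalIntegral.integral_eq_sub_of_hasDerivAt
        (f := fun w => -(1 / 2) * Real.log (1 - w ^ 2)) (fun w hw => ?_)
        ((hcont hx).intervalIntegrable_of_Icc (hle hx))
      rw [uIcc_of_le (hle hx)] at hw
      have hpos : 0 < 1 - w ^ 2 := lt_of_lt_of_le (inv_pos.2 hx0) (hsq hx hw).2
      have := ((((hasDerivAt_id w).pow 2).const_sub 1).log hpos.ne').const_mul (-(1 / 2))
      refine this.congr_deriv ?_
      rw [show δ - δ - 1 = -1 by ring, Real.rpow_neg_one]
      simp
      field_simp
    have hx1 : x⁻¹ ≤ 1 := inv_le_one_of_one_le₀ (by linarith)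
    have e2 : 1 - √(1 - x⁻¹) ^ 2 = x⁻¹ := by rw [Real.sq_sqrt (by linarith)]; ring
    have e3 : (1 : ℝ) - √(1 / 2) ^ 2 = 2⁻¹ := by rw [Real.sq_sqrt (by norm_num)]; norm_num
    rw [h1, e2, e3, Real.log_inv, Real.log_inv, hn, Real.log_pow]
    have h4 : Real.log 4 ≤ Real.log x := Real.log_le_log (by norm_num) hx
    have h5 : Real.log 4 = 2 * Real.log 2 := by
      rw [show (4 : ℝ) = 2 ^ 2 by norm_num, Real.log_pow]; norm_num
    push_cast
    linarith
  · refine ⟨∫ w in √(1 / 2)..√(1 - (4 : ℝ)⁻¹), w * (1 - w ^ 2) ^ (l - δ - 1), ?_,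
      fun n x hx hn => ?_⟩
    · refine intervalIntegral.intervalIntegral_pos_of_pos_on
        ((hcont le_rfl).intervalIntegrable_of_Icc (hle le_rfl)) (fun w hw => ?_)
        (Real.sqrt_lt_sqrt (by norm_num) (by norm_num))
      obtain ⟨h0, h1⟩ := hsq le_rfl ⟨hw.1.le, hw.2.le⟩
      have : 0 < 1 - w ^ 2 := lt_of_lt_of_le (by norm_num) h1
      positivity
    · rw [if_neg hlt.ne, mul_one]
      have hab : √(1 - (4 : ℝ)⁻¹) ≤ √(1 - x⁻¹) := by
        refine Real.sqrt_le_sqrt ?_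
        have : x⁻¹ ≤ 4⁻¹ := inv_anti₀ (by norm_num) hx
        linarith
      refine intervalIntegral.integral_mono_interval le_rfl (hle le_rfl) hab ?_
        ((hcont hx).intervalIntegrable_of_Icc (hle hx))
      refine (ae_restrict_iff' measurableSet_Ioc).2 (Eventually.of_forall fun w hw => ?_)
      obtain ⟨h0, h1⟩ := hsq hx ⟨hw.1.le, hw.2⟩
      have : 0 < 1 - w ^ 2 := lt_of_lt_of_le (inv_pos.2 (by linarith)) h1
      simp only [Pi.zero_apply]
      positivity

/-- The errors are a power of `x` times `x ^ (-K)` or `exp (-(x / 2))`. They are absorbed by the main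
term once `K` is large. -/
lemma eventually_error_le (C ν ε : ℝ) (q K : ℕ) (hε : 0 < ε) (hK : 4 * q + ν + 1 ≤ (K : ℝ)) :
    ∀ᶠ x : ℝ in atTop, C * (x ^ 4 + 1) ^ q * (x⁻¹ ^ K + Real.exp (-(x / 2))) ≤ ε * x ^ (-ν) := by
  have h1 := tendsto_rpow_mul_exp_neg_mul_atTop_nhds_zero (4 * q + ν) (1 / 2) (by norm_num)
  have h2 := tendsto_inv_atTop_zero (𝕜 := ℝ)
  have h3 : Tendsto (fun x : ℝ => |C| * 2 ^ q * (x⁻¹ + x ^ (4 * q + ν) * Real.exp (-(1 / 2) * x)))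
      atTop (𝓝 0) := by
    simpa using (h2.add h1).const_mul (|C| * 2 ^ q)
  filter_upwards [h3.eventually_le_const hε, eventually_ge_atTop 1] with x hx hx1
  have hx0 : 0 < x := by linarith
  have h4 : x⁻¹ ^ K ≤ x⁻¹ * x ^ (-(4 * q + ν)) := by
    rw [← Real.rpow_neg_one, ← Real.rpow_natCast, ← Real.rpow_mul hx0.le, ← Real.rpow_add hx0]
    exact Real.rpow_le_rpow_of_exponent_le hx1 (by linarith)
  have h5 : (x ^ 4 + 1) ^ q ≤ 2 ^ q * x ^ (4 * q : ℝ) := by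
    have : x ^ (4 * q : ℝ) = (x ^ 4) ^ q := by
      rw [← pow_mul, ← Real.rpow_natCast]; push_cast; rfl
    rw [this, ← mul_pow]
    have : 1 ≤ x ^ 4 := one_le_pow₀ hx1
    exact pow_le_pow_left₀ (by positivity) (by linarith) q
  have hr : x ^ (4 * q : ℝ) * x ^ (-(4 * q + ν)) = x ^ (-ν) := by
    rw [← Real.rpow_add hx0]; congr 1; ring
  have hr2 : x ^ (-ν) * x ^ (4 * q + ν) = x ^ (4 * q : ℝ) := by
    rw [← Real.rpow_add hx0]; congr 1; ring
  have he : Real.exp (-(x / 2)) = Real.exp (-(1 / 2) * x) := by congr 1; ring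
  calc C * (x ^ 4 + 1) ^ q * (x⁻¹ ^ K + Real.exp (-(x / 2)))
      ≤ |C| * (2 ^ q * x ^ (4 * q : ℝ)) *
          (x⁻¹ * x ^ (-(4 * q + ν)) + Real.exp (-(x / 2))) := by
        gcongr
        exact le_abs_self C
    _ = |C| * 2 ^ q * (x⁻¹ * (x ^ (4 * q : ℝ) * x ^ (-(4 * q + ν)))
          + x ^ (4 * q : ℝ) * Real.exp (-(x / 2))) := by ring
    _ = |C| * 2 ^ q * (x⁻¹ + x ^ (4 * q + ν) * Real.exp (-(1 / 2) * x)) * x ^ (-ν) := by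
        rw [hr, he, ← hr2]; ring
    _ ≤ ε * x ^ (-ν) := by gcongr

/-- A lower bound for large `n` extends to all `n ≥ 1` with a smaller constant, since the finitely
many remaining values of `R` are positive. -/
lemma exists_const_of_eventually {t R : ℕ → ℝ} (hR : ∀ n, 1 ≤ n → 0 < R n)
    (ht : ∀ n, 1 ≤ n → 0 ≤ t n) (h : ∃ c : ℝ, 0 < c ∧ ∀ᶠ n in atTop, c * t n ≤ R n) :
    ∃ c : ℝ, 0 < c ∧ ∀ n, 1 ≤ n → c * t n ≤ R n := by
  obtain ⟨c, hc, h⟩ := h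
  obtain ⟨N, hN⟩ := eventually_atTop.1 h
  have key : ∀ m : ℕ, ∃ c : ℝ, 0 < c ∧ ∀ n, 1 ≤ n → (n < m ∨ N ≤ n) → c * t n ≤ R n := by
    intro m
    induction m with
    | zero => exact ⟨c, hc, fun n _ hn => hN n (hn.resolve_left (by omega))⟩
    | succ m ih =>
      obtain ⟨c', hc', h'⟩ := ih
      rcases Nat.eq_zero_or_pos m with rfl | hm
      · exact ⟨c', hc', fun n h1 hn => h' n h1 (Or.inr (hn.resolve_left (by omega)))⟩
      have hRm := hR m hm
      have htm := ht m hm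
      refine ⟨min c' (R m / (t m + 1)), lt_min hc' (by positivity), fun n h1 hn => ?_⟩
      rcases eq_or_ne n m with rfl | hne
      · calc _ ≤ R n / (t n + 1) * t n := by gcongr; exact min_le_right _ _
          _ ≤ R n := by
            rw [div_mul_eq_mul_div, div_le_iff₀ (by positivity)]; nlinarith
      · refine le_trans ?_ (h' n h1 (hn.imp_left fun _ => by omega))
        have := ht n h1
        gcongr
        exact min_le_left _ _
  obtain ⟨c', hc', h'⟩ := key N
  exact ⟨c', hc', fun n h1 => h' n h1 (lt_or_ge n N)⟩

lemma integral_abs_gegenbauer_pos (n : ℕ) (hn : 1 ≤ n) {α β μ l : ℝ} (hμ : 0 ≤ μ) (hl : 0 ≤ l)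
    (hs : 0 < α + β + 1) (hd : β < α) :
    0 < ∫ y in (0 : ℝ)..1, |gegenbauerIntegral μ (fun t => (jacobiP n α β).eval (t * y))|
            * |y| ^ (2 * μ) * (1 - y ^ 2) ^ (l - 1 / 2) := by
  rw [integral_cos_substitution
    (fun y => gegenbauerIntegral μ (fun t => (jacobiP n α β).eval (t * y)))]
  simp only [← eval_gegenbauerPoly n α β hμ]
  set G := gegenbauerPoly n α β μ
  have hGc : Continuous fun w => G.eval w := G.continuous
  have hcont : Continuous fun θ =>
      |G.eval (Real.cos θ)| * |Real.cos θ| ^ (2 * μ) * |Real.sin θ| ^ (2 * l) := by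
    refine ((hGc.comp Real.continuous_cos).abs.mul ?_).mul ?_
    · exact Real.continuous_cos.abs.rpow_const fun _ => Or.inr (by linarith)
    · exact Real.continuous_sin.abs.rpow_const fun _ => Or.inr (by linarith)
  obtain ⟨y, hy, hy0⟩ : ∃ y ∈ Ioo (0 : ℝ) 1, G.eval y ≠ 0 := by
    by_contra hcon
    push Not at hcon
    exact gegenbauerPoly_ne_zero n hn hμ hs hd
      (Polynomial.eq_zero_of_infinite_isRoot G ((Ioo_infinite zero_lt_one).mono hcon))
  have hcos : Real.cos (Real.arccos y) = y := Real.cos_arccos (by linarith [hy.1]) hy.2.le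
  have hsin : 0 < Real.sin (Real.arccos y) := by
    rw [Real.sin_arccos]; exact Real.sqrt_pos.2 (by nlinarith [hy.1, hy.2])
  refine intervalIntegral.integral_pos (by positivity) hcont.continuousOn
    (fun θ _ => by positivity) ⟨Real.arccos y,
      ⟨Real.arccos_nonneg y, Real.arccos_le_pi_div_two.2 hy.1.le⟩, ?_⟩
  rw [hcos, abs_of_pos hsin, abs_of_pos hy.1]
  have := hy.1
  positivity

end Estimates

/-! ### The lower bound for the integral -/

section Final

open MeasureTheory Set Filter Topology

/-- Pointwise lower bounds for the integrand on the radius `(0, 1)`, for all large `n = x ^ 4`: it is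
nowhere very negative, and for `1 / 2 ≤ w ^ 2 ≤ 1 - x⁻¹` it has the main term
`n ^ (-μ - 1 / 2) * w * (1 - w ^ 2) ^ (l - δ - 1)`, as `(1 - w ^ 2)` enters with the exponent `2 * l`
from the weight, `μ` from the Gegenbauer integral and `-(l + μ + δ + 1)` from the Jacobi
polynomial. -/
lemma exists_le_radial_integrand {l μ δ : ℝ} (hl : 0 ≤ l) (hμ : 0 ≤ μ) (hδ : -1 < δ) (K p q : ℕ)
    (hKl : 2 * l ≤ K) (hq : l + μ + δ + 1 / 2 ≤ q) :
    ∃ c C : ℝ, 0 < c ∧ 0 ≤ C ∧ ∀ (n : ℕ) (x w : ℝ), 14 ≤ x → 2 * l + 2 * μ + δ + 1 ≤ x →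
      (n : ℝ) = x ^ 4 → 0 < w → w < 1 →
      (-(C * (x ^ 4 + 1) ^ q * (x⁻¹ ^ K + Real.exp (-(x / 2)))) ≤
        w ^ (n % 2) * (gegenbauerLift n (l + μ + δ + 1 / 2) (l + μ - 1 / 2) μ).eval w *
          radialWeight l x⁻¹ K p w) ∧
      (1 / 2 ≤ w ^ 2 → x⁻¹ ≤ 1 - w ^ 2 →
        c * (n : ℝ) ^ (-μ - 1 / 2) * (w * (1 - w ^ 2) ^ (l - δ - 1))
          - C * (x ^ 4 + 1) ^ q * (x⁻¹ ^ K + Real.exp (-(x / 2))) ≤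
        w ^ (n % 2) * (gegenbauerLift n (l + μ + δ + 1 / 2) (l + μ - 1 / 2) μ).eval w *
          radialWeight l x⁻¹ K p w) := by
  obtain ⟨c₁, hc₁, h₁⟩ := exists_le_evenLift (B := l + μ) (d := δ + 1) (by linarith) (by linarith)
  obtain ⟨c₂, C, hc₂, hC, h₂⟩ := exists_le_gegenbauerIntegral_jacobiP hμ
  refine ⟨c₁ * c₂ * 2 ^ (2 * l - K), C * 2 ^ p, by positivity, by positivity,
    fun n x w hx hxs hnx hw0 hw1 => ?_⟩
  have eα : l + μ + (δ + 1) - 1 / 2 = l + μ + δ + 1 / 2 := by ring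
  rw [eα] at h₁
  set α := l + μ + δ + 1 / 2 with hα
  set β := l + μ - 1 / 2 with hβ
  have hs : 0 < α + β + 1 := by rw [hα, hβ]; linarith
  have hd : β ≤ α := by rw [hα, hβ]; linarith
  have hx0 : 0 < x := by linarith
  have hn1 : 1 ≤ n := by
    have : (1 : ℝ) ≤ n := by rw [hnx]; exact one_le_pow₀ (by linarith)
    exact_mod_cast this
  have hn0 : (0 : ℝ) < n := by exact_mod_cast hn1
  obtain ⟨hA, hB⟩ := h₂ n α β w hn1 hs hd hw0 hw1
  rw [← eval_gegenbauerLift n α β hμ hw0.ne'] at hA hB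
  set H := (gegenbauerLift n α β μ).eval w
  set Ω := radialWeight l x⁻¹ K p w with hΩ
  set U := (jacobiLift n α β).eval 1
  have hΩ0 : 0 ≤ Ω := radialWeight_nonneg l (inv_pos.2 hx0) K p (by nlinarith)
  have hU0 : 0 ≤ U := (abs_nonneg _).trans (abs_eval_jacobiP_le n hs hd (x := 0) (by simp))
  have hUq : U ≤ (x ^ 4 + 1) ^ q := by
    rw [← hnx]; exact eval_one_jacobiLift_le n q β (by rw [hα]; linarith) hq
  have hwe0 : 0 ≤ w ^ (n % 2) := by positivity
  have hwe1 : w ^ (n % 2) ≤ 1 := pow_le_one₀ hw0.le hw1.le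
  have hΩw := radialWeight_mul_pow_le p n hl hKl (by linarith) hnx hw0 hw1
  have hx4 : 0 ≤ (x ^ 4 + 1) ^ q := by positivity
  have herr : w ^ (n % 2) * (C * U * w ^ n) * Ω ≤
      C * 2 ^ p * (x ^ 4 + 1) ^ q * (x⁻¹ ^ K + Real.exp (-(x / 2))) := by
    have hwn : 0 ≤ Ω * w ^ n := by positivity
    calc w ^ (n % 2) * (C * U * w ^ n) * Ω = w ^ (n % 2) * (C * U * (Ω * w ^ n)) := by ring
      _ ≤ 1 * (C * (x ^ 4 + 1) ^ q * (2 ^ p * (x⁻¹ ^ K + Real.exp (-(x / 2))))) := by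
          gcongr
      _ = _ := by ring
  constructor
  · have := mul_le_mul_of_nonneg_right (mul_le_mul_of_nonneg_left hA hwe0) hΩ0
    linarith
  · intro hw2 hρ
    set ρ := 1 - w ^ 2 with hρd
    have hρ0 : 0 < ρ := lt_of_lt_of_le (inv_pos.2 hx0) hρ
    have hxρ : 1 ≤ x * ρ := by
      calc (1 : ℝ) = x * x⁻¹ := (mul_inv_cancel₀ hx0.ne').symm
        _ ≤ _ := by gcongr
    -- a truncation at `M` of the order of `n ^ (1 / 4)` covers `1 - w ^ 2 ≥ n ^ (-1 / 4)` and stays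
    -- in the range `O(√n)` where the Fourier coefficients are controlled
    set M := ⌈x⌉₊ with hM
    have hxM : x ≤ M := Nat.le_ceil x
    have hMx : (M : ℝ) < x + 1 := Nat.ceil_lt_add_one hx0.le
    have hMn : (4 * M + 1 : ℝ) * (2 * (l + μ) + (δ + 1) + (4 * M + 1)) ≤ n / 2 := by
      rw [hnx]
      have a1 : (4 * M + 1 : ℝ) ≤ 5 * x := by linarith
      have a2 : 2 * (l + μ) + (δ + 1) + (4 * M + 1) ≤ 6 * x := by linarith
      calc (4 * M + 1 : ℝ) * (2 * (l + μ) + (δ + 1) + (4 * M + 1)) ≤ 5 * x * (6 * x) := by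
            gcongr
            have : (0 : ℝ) ≤ M := M.cast_nonneg
            linarith
        _ ≤ x ^ 4 / 2 := by
            have : 14 ^ 2 ≤ x ^ 2 := pow_le_pow_left₀ (by norm_num) hx 2
            nlinarith [sq_nonneg x]
    have hV := h₁ n M w hn1 hMn hw0 hw2 (by linarith)
      (hxρ.trans (mul_le_mul_of_nonneg_right hxM hρ0.le))
    have hG := hB hw2 (by
      rw [hnx]
      have : (14 : ℝ) ^ 3 ≤ x ^ 3 := pow_le_pow_left₀ (by norm_num) hx 3
      nlinarith)
    have hW := le_radialWeight (l := l) (K := K) p (inv_pos.2 hx0) hKl hρ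
    rw [← hΩ] at hW
    have hwe : w ≤ w ^ (n % 2) := by
      rcases Nat.mod_two_eq_zero_or_one n with h | h <;> rw [h]
      · rw [pow_zero]; exact hw1.le
      · rw [pow_one]
    have hnr : (n : ℝ) ^ (-μ - 1 / 2) = ((n : ℝ) ^ μ)⁻¹ * (√n)⁻¹ := by
      rw [Real.sqrt_eq_rpow, ← Real.rpow_neg hn0.le, ← Real.rpow_neg hn0.le, ← Real.rpow_add hn0]
      congr 1
    have hρr : ρ ^ (l - δ - 1) = ρ ^ μ * ρ ^ (-(l + μ + (δ + 1))) * ρ ^ (2 * l) := by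
      rw [← Real.rpow_add hρ0, ← Real.rpow_add hρ0]; congr 1; ring
    have hV0 : 0 ≤ w ^ (n % 2) * (c₂ * (ρ / n) ^ μ * evenLift n α β w) := by
      have := evenLift_nonneg n hs hd hw0.le
      positivity
    have hmain : c₁ * c₂ * 2 ^ (2 * l - K) * (n : ℝ) ^ (-μ - 1 / 2) * (w * ρ ^ (l - δ - 1)) ≤
        w ^ (n % 2) * (c₂ * (ρ / n) ^ μ * evenLift n α β w) * Ω := by
      calc _ = w * (c₂ * (ρ / n) ^ μ * (c₁ / √n * ρ ^ (-(l + μ + (δ + 1))))) *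
              (2 ^ (2 * l - K) * ρ ^ (2 * l)) := by
            rw [hnr, hρr, Real.div_rpow hρ0.le hn0.le]
            ring
        _ ≤ _ := by gcongr
    have := mul_le_mul_of_nonneg_right (mul_le_mul_of_nonneg_left hG hwe0) hΩ0
    linarith

theorem mainTheorem7 (lam μ δ a b : ℝ) (hlam : 0 ≤ lam) (hμ : 0 ≤ μ)
    (hδlam : δ ≤ lam) (hδ : -1 < δ) (ha : a = lam + μ + δ) (hb : b = lam + μ - 1) :
    ∃ c : ℝ, 0 < c ∧ ∀ n : ℕ, 1 ≤ n →
      c * (n : ℝ) ^ (-μ - 1 / 2) * (if δ = lam then Real.log n else 1) ≤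
        ∫ y in (0 : ℝ)..1,
          |gegenbauerIntegral μ (fun t => (jacobiP n (a + 1 / 2) (b + 1 / 2)).eval (t * y))|
            * |y| ^ (2 * μ) * (1 - y ^ 2) ^ (lam - 1 / 2) := by
  have eα : a + 1 / 2 = lam + μ + δ + 1 / 2 := by rw [ha]
  have eβ : b + 1 / 2 = lam + μ - 1 / 2 := by rw [hb]; ring
  rw [eα, eβ]
  set α := lam + μ + δ + 1 / 2 with hα
  set β := lam + μ - 1 / 2 with hβ
  have hs : 0 < α + β + 1 := by rw [hα, hβ]; linarith
  have hd : β < α := by rw [hα, hβ]; linarith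
  set R : ℕ → ℝ := fun n => ∫ y in (0 : ℝ)..1,
    |gegenbauerIntegral μ (fun t => (jacobiP n α β).eval (t * y))|
            * |y| ^ (2 * μ) * (1 - y ^ 2) ^ (lam - 1 / 2) with hR
  set t : ℕ → ℝ := fun n => (n : ℝ) ^ (-μ - 1 / 2) * (if δ = lam then Real.log n else 1) with ht
  suffices h : ∃ c : ℝ, 0 < c ∧ ∀ᶠ n in atTop, c * t n ≤ R n by
    have ht0 : ∀ n, 0 ≤ t n := fun n => by
      have : 0 ≤ Real.log n := Real.log_natCast_nonneg n
      simp only [ht]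
      split_ifs <;> positivity
    obtain ⟨c, hc, h⟩ := exists_const_of_eventually
      (fun n hn => integral_abs_gegenbauer_pos n hn hμ hlam hs hd) (fun n _ => ht0 n) h
    exact ⟨c, hc, fun n hn => by rw [mul_assoc]; exact h n hn⟩
  -- `q` controls the growth of `P_n^{(α,β)}(1)`, and `K` is so large that the error terms are
  -- smaller than the main term, of size `n ^ (-μ - 1 / 2) = x ^ (-(4 * μ + 2))` for `n = x ^ 4`
  obtain ⟨q, hq⟩ := exists_nat_ge α
  obtain ⟨p, hp⟩ := exists_nat_ge (2 * μ)
  obtain ⟨K, hK⟩ := exists_nat_ge (4 * q + (4 * μ + 2) + 1 + 2 * lam)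
  have hq0 : (0 : ℝ) ≤ q := q.cast_nonneg
  have hK1 : 1 ≤ K := by
    have : (1 : ℝ) ≤ K := by linarith
    exact_mod_cast this
  have hKl : 2 * lam ≤ K := by linarith
  obtain ⟨c, C, hc, hC, hpt⟩ := exists_le_radial_integrand hlam hμ hδ K p q hKl hq
  obtain ⟨c', hc', hrad⟩ := exists_le_integral_radius hδlam
  refine ⟨c * c' / 2 / 2 ^ (2 * lam + p), by positivity, ?_⟩
  have herr := eventually_error_le C (4 * μ + 2) (c * c' / 2) q K (by positivity) (by linarith)
  have hx14 := eventually_ge_atTop (14 : ℝ)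
  have hxs := eventually_ge_atTop (2 * lam + 2 * μ + δ + 1)
  have hlim : Tendsto (fun n : ℕ => (n : ℝ) ^ (1 / 4 : ℝ)) atTop atTop :=
    (tendsto_rpow_atTop (by norm_num)).comp tendsto_natCast_atTop_atTop
  filter_upwards [hlim.eventually (herr.and (hx14.and hxs)), eventually_ge_atTop 3]
    with n ⟨herr, hx14, hxs⟩ hn3
  have hn0 : (0 : ℝ) < n := by exact_mod_cast (by omega : 0 < n)
  set x := (n : ℝ) ^ (1 / 4 : ℝ) with hx
  have hnx : (n : ℝ) = x ^ 4 := by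
    rw [hx, ← Real.rpow_natCast, ← Real.rpow_mul hn0.le]; norm_num
  have hx0 : 0 < x := by linarith
  have hxn : x ^ (-(4 * μ + 2)) = (n : ℝ) ^ (-μ - 1 / 2) := by
    rw [hx, ← Real.rpow_mul hn0.le]; congr 1; ring
  -- the bound for the negative part of the integrand on the radius
  set E := C * (x ^ 4 + 1) ^ q * (x⁻¹ ^ K + Real.exp (-(x / 2))) with hE
  have hE0 : 0 ≤ E := by positivity
  set F : ℝ → ℝ := fun w => w ^ (n % 2) * (gegenbauerLift n α β μ).eval w *
    radialWeight lam x⁻¹ K p w with hF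
  have hcontour : ∫ w in (0 : ℝ)..1, F w ≤ 2 ^ (2 * lam + p) * R n :=
    integral_lift_le n α β K p hμ hlam (inv_pos.2 hx0) hK1 hKl hp
  have hFc : ContinuousOn F (Icc 0 1) := by
    have h1 : ContinuousOn (fun w : ℝ => (1 + x⁻¹ - w ^ 2) ^ (2 * lam - K)) (Icc 0 1) :=
      ContinuousOn.rpow_const (by fun_prop) fun w hw => Or.inl (by
        have : 0 < x⁻¹ := inv_pos.2 hx0
        nlinarith [hw.1, hw.2])
    have h2 : Continuous fun w => (gegenbauerLift n α β μ).eval w :=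
      (gegenbauerLift n α β μ).continuous
    exact ContinuousOn.mul (by fun_prop) (ContinuousOn.mul (ContinuousOn.mul (by fun_prop) h1)
      (by fun_prop))
  set wa := √(1 / 2 : ℝ) with hwa
  set wb := √(1 - x⁻¹) with hwb
  have hxi : x⁻¹ ≤ 4⁻¹ := inv_anti₀ (by norm_num) (by linarith)
  have hxi0 : 0 < x⁻¹ := inv_pos.2 hx0
  have hwa0 : 0 < wa := Real.sqrt_pos.2 (by norm_num)
  have hab : wa ≤ wb := Real.sqrt_le_sqrt (by linarith)
  have hwb1 : wb < 1 := by
    rw [hwb, Real.sqrt_lt' one_pos]; linarith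
  have hFi : ∀ u v : ℝ, 0 ≤ u → u ≤ v → v ≤ 1 → IntervalIntegrable F volume u v :=
    fun u v hu huv hv => (hFc.mono (Icc_subset_Icc hu hv)).intervalIntegrable_of_Icc huv
  have hlow : ∀ u v : ℝ, 0 ≤ u → u ≤ v → v ≤ 1 → -(E * (v - u)) ≤ ∫ w in u..v, F w := by
    intro u v hu huv hv
    have : ∫ w in u..v, (-E) ≤ ∫ w in u..v, F w :=
      intervalIntegral.integral_mono_on_of_le_Ioo huv intervalIntegrable_const
        (hFi u v hu huv hv) fun w hw =>
          (hpt n x w hx14 hxs hnx (by linarith [hw.1]) (by linarith [hw.2])).1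
    rw [intervalIntegral.integral_const, smul_eq_mul] at this
    linarith
  have hmid : c * (n : ℝ) ^ (-μ - 1 / 2) *
      (∫ w in wa..wb, w * (1 - w ^ 2) ^ (lam - δ - 1)) - E * (wb - wa) ≤ ∫ w in wa..wb, F w := by
    have hsq : ∀ w ∈ Icc wa wb, 0 < w ∧ 1 / 2 ≤ w ^ 2 ∧ x⁻¹ ≤ 1 - w ^ 2 := by
      intro w hw
      have h0 : 0 < w := lt_of_lt_of_le hwa0 hw.1
      have h1 := pow_le_pow_left₀ hwa0.le hw.1 2
      have h2 := pow_le_pow_left₀ h0.le hw.2 2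
      rw [hwa, Real.sq_sqrt (by norm_num)] at h1
      rw [hwb, Real.sq_sqrt (by linarith)] at h2
      exact ⟨h0, h1, by linarith⟩
    have hi : IntervalIntegrable (fun w : ℝ => w * (1 - w ^ 2) ^ (lam - δ - 1)) volume wa wb := by
      refine ContinuousOn.intervalIntegrable_of_Icc hab (continuousOn_id.mul
        (ContinuousOn.rpow_const (by fun_prop) fun w hw => Or.inl ?_))
      have := (hsq w hw).2.2
      linarith
    have : ∫ w in wa..wb, (c * (n : ℝ) ^ (-μ - 1 / 2) * (w * (1 - w ^ 2) ^ (lam - δ - 1)) - E) ≤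
        ∫ w in wa..wb, F w := by
      refine intervalIntegral.integral_mono_on_of_le_Ioo hab
        ((hi.const_mul _).sub intervalIntegrable_const) (hFi _ _ hwa0.le hab hwb1.le)
        fun w hw => ?_
      obtain ⟨h0, h1, h2⟩ := hsq w ⟨hw.1.le, hw.2.le⟩
      exact (hpt n x w hx14 hxs hnx h0 (by linarith [hw.2])).2 h1 h2
    rw [intervalIntegral.integral_sub (hi.const_mul _) intervalIntegrable_const,
      intervalIntegral.integral_const_mul, intervalIntegral.integral_const, smul_eq_mul] at this
    linarith
  have hwa1 : wa ≤ 1 := hab.trans hwb1.le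
  have hl1 := hlow 0 wa le_rfl hwa0.le hwa1
  have hl2 := hlow wb 1 (hwa0.le.trans hab) hwb1.le le_rfl
  have hsplit : ∫ w in (0 : ℝ)..1, F w =
      (∫ w in (0 : ℝ)..wa, F w) + (∫ w in wa..wb, F w) + ∫ w in wb..1, F w := by
    rw [intervalIntegral.integral_add_adjacent_intervals (hFi 0 wa le_rfl hwa0.le hwa1)
      (hFi wa wb hwa0.le hab hwb1.le), intervalIntegral.integral_add_adjacent_intervals
      (hFi 0 wb le_rfl (hwa0.le.trans hab) hwb1.le) (hFi wb 1 (hwa0.le.trans hab) hwb1.le le_rfl)]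
  have hrad' := hrad n x (by linarith) hnx
  set L : ℝ := if δ = lam then Real.log n else 1 with hL
  have hL1 : 1 ≤ L := by
    rw [hL]
    split_ifs
    · rw [Real.le_log_iff_exp_le hn0]
      have : (3 : ℝ) ≤ n := by exact_mod_cast hn3
      linarith [Real.exp_one_lt_d9]
    · exact le_rfl
  rw [hxn] at herr
  have hnpos : 0 < (n : ℝ) ^ (-μ - 1 / 2) := by positivity
  have hEt : E ≤ c * c' / 2 * ((n : ℝ) ^ (-μ - 1 / 2) * L) :=
    herr.trans (by gcongr; exact le_mul_of_one_le_right hnpos.le hL1)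
  have hm : c * c' * ((n : ℝ) ^ (-μ - 1 / 2) * L) ≤ c * (n : ℝ) ^ (-μ - 1 / 2) *
      (∫ w in wa..wb, w * (1 - w ^ 2) ^ (lam - δ - 1)) := by
    calc _ = c * (n : ℝ) ^ (-μ - 1 / 2) * (c' * L) := by ring
      _ ≤ _ := by gcongr
  have hfin : c * c' / 2 * ((n : ℝ) ^ (-μ - 1 / 2) * L) ≤ 2 ^ (2 * lam + p) * R n := by
    linarith
  rw [div_mul_eq_mul_div, div_le_iff₀ (by positivity)]
  linarith

end Final
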